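/- Work over $\mathbb C$. Let $\mathbb A^2=\{u_0\neq 0\}\subset\mathbb P^2=\operatorname{Proj}\mathbb C[u_0,u_1,u_2]$, with coordinates $t_i=u_i/u_0$, and let $\check{\mathbb P}^2=\operatorname{Proj}\mathbb C[v_0,v_1,v_2]$ be the dual projective plane of lines in $\mathbb P^2$, with the dual coordinates. For $x\in\mathbb P^2$ let $\lambda_x\subset\check{\mathbb P}^2$ be the line formed by all lines of $\mathbb P^2$ through $x$; put $\check{\mathbb P}^1_W=\{v_0=0\}$ and $\check{\mathbb P}^0_{F'F''}=\{v_1=v_2=0\}=[1:0:0]$. The torus $\mathbb G_m^2$ acts on $\mathbb A^2$ by $(s_1,s_2)\cdot(t_1,t_2)=(s_1t_1,s_2t_2)$, hence on $\mathbb P^2$ and, by duality, on $\check{\mathbb P}^2$. Consider the category of $\mathbb G_m^2$-equivariant algebraic vector bundles on $\check{\mathbb P}^2$ and equivariant morphisms of bundles. Let $\mathcal P$ have as objects the equivariant bundles whose underlying bundle is trivial on the line $\check{\mathbb P}^1_W$, and as morphisms the equivariant morphisms of bundles which have constant rank on $\check{\mathbb P}^2\setminus\{\check{\mathbb P}^0_{F'F''}\}$.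 Let $\mathcal Q$ have as objects the equivariant bundles whose underlying bundle is trivial on every line $\lambda_x$ with $x\in\mathbb A^2$, and as morphisms all equivariant morphisms of bundles. **Lemma.** The morphisms of $\mathcal P$ contain the identities and are closed under composition, so that $\mathcal P$ is a category, and the categories $\mathcal P$ and $\mathcal Q$ are equivalent, by an equivalence that is compatible, up to natural isomorphism, with their inclusions into the category of all $\mathbb G_m^2$-equivariant vector bundles on $\check{\mathbb P}^2$. -/

import Mathlib

open CategoryTheory MvPolynomial
open scoped LinearAlgebra.Projectivization

noncomputable section

namespace EquivariantPlane

/-! ### The dual projective plane, its lines, and the torus action -/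

/-- The projective plane `ℙ²` over `ℂ`, with homogeneous coordinates `[u₀ : u₁ : u₂]`. -/
abbrev Plane : Type := ℙ ℂ (Fin 3 → ℂ)

/-- The dual projective plane (the plane of lines of `ℙ²`), with the dual homogeneous coordinates
`[v₀ : v₁ : v₂]`; the point `v` is the line `v₀ u₀ + v₁ u₁ + v₂ u₂ = 0`. -/
abbrev DualPlane : Type := ℙ ℂ (Fin 3 → ℂ)

/-- The point `[1 : t₁ : t₂]` of `ℙ²`, for `(t₁, t₂)` in the affine plane `𝔸² = {u₀ ≠ 0}`. -/
def affinePoint (t : Fin 2 → ℂ) : Plane :=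
  Projectivization.mk ℂ ![1, t 0, t 1] (fun h => one_ne_zero (congrFun h 0))

/-- The line `λ_x` in the dual plane: all lines of `ℙ²` through the point `x`. -/
def dualLine (x : Plane) : Set DualPlane := {p | Projectivization.orthogonal x p}

/-- The coordinate line `ℙ¹_W = {v₀ = 0}` of the dual plane. -/
def lineW : Set DualPlane := {p | p.rep 0 = 0}

/-- The torus fixed point `{v₁ = v₂ = 0} = [1 : 0 : 0]` of the dual plane. -/
def basePoint : DualPlane :=
  Projectivization.mk ℂ ![1, 0, 0] (fun h => one_ne_zero (congrFun h 0))

/-- The complex points of the torus `𝔾_m²`. -/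
abbrev Torus : Type := Fin 2 → ℂˣ

/-- The coordinatewise action of diagonal matrices on `ℂ³` is linear; so they act on the
projective planes. -/
instance : SMulCommClass (Fin 3 → ℂˣ) ℂ (Fin 3 → ℂ) where
  smul_comm c a v := by
    ext i
    exact smul_comm (c i) a (v i)

/-- `t ↦ (1, t₁, t₂)`: the torus acts on `ℙ²` through these diagonal matrices, which extends the
standard action `(t₁ x₁, t₂ x₂)` on `𝔸²`. -/
def planeDiag : Torus →* (Fin 3 → ℂˣ) where
  toFun t := ![1, t 0, t 1]
  map_one' := by ext i; fin_cases i <;> rfl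
  map_mul' s t := by ext i; fin_cases i <;> simp

/-- The dual action on the dual plane is
`t • [v₀ : v₁ : v₂] = [v₀ : t₁⁻¹ v₁ : t₂⁻¹ v₂]`. -/
instance : MulAction Torus DualPlane := MulAction.compHom DualPlane planeDiag⁻¹

/-- The torus moves a line and the points on it compatibly. -/
theorem dualLine_smul (t : Torus) (x : Plane) (p : DualPlane) :
    t • p ∈ dualLine (planeDiag t • x) ↔ p ∈ dualLine x := by
  induction x using Projectivization.ind with
  | h u hu =>
    induction p using Projectivization.ind with
    | h v hv =>
      change Projectivization.orthogonal (planeDiag t • Projectivization.mk ℂ u hu)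
        (planeDiag⁻¹ t • Projectivization.mk ℂ v hv) ↔ _
      rw [Projectivization.smul_mk, Projectivization.smul_mk, dualLine, Set.mem_ofPred_eq,
        Projectivization.orthogonal_mk, Projectivization.orthogonal_mk]
      simp only [dotProduct, MonoidHom.inv_apply, Pi.smul_apply', Pi.inv_apply, Units.smul_def,
        smul_eq_mul]
      have key : ∀ i, (planeDiag t i : ℂ) * u i * ((((planeDiag t i)⁻¹ : ℂˣ) : ℂ) * v i)
          = u i * v i := fun i => by
        rw [mul_mul_mul_comm, Units.mul_inv, one_mul]
      simp only [key]

/-! ### Zariski topology and regular functions -/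

/-- Zariski open sets of the dual plane: the unions of sets `{G ≠ 0}`, `G` homogeneous. -/
def IsZariskiOpen (U : Set DualPlane) : Prop :=
  ∀ p ∈ U, ∃ (d : ℕ) (G : MvPolynomial (Fin 3) ℂ), G.IsHomogeneous d ∧
    eval p.rep G ≠ 0 ∧ ∀ q : DualPlane, eval q.rep G ≠ 0 → q ∈ U

/-- A function on a subset `Z` of the dual plane is regular if, near every point of `Z`, it is
the quotient of two homogeneous polynomials of the same degree. -/
def IsRegular {Z : Set DualPlane} (f : Z → ℂ) : Prop :=
  ∀ p : Z, ∃ (d : ℕ) (F G : MvPolynomial (Fin 3) ℂ), F.IsHomogeneous d ∧ G.IsHomogeneous d ∧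
    eval p.1.rep G ≠ 0 ∧
    ∀ q : Z, eval q.1.rep G ≠ 0 → f q = eval q.1.rep F / eval q.1.rep G

/-- The value at `(t, p)` of a polynomial in `v₀, v₁, v₂` whose coefficients are polynomials in
`t₁, t₂`. -/
def evalPair (z : Torus × DualPlane) (F : MvPolynomial (Fin 3) (MvPolynomial (Fin 2) ℂ)) : ℂ :=
  eval z.2.rep (map (eval fun k => (z.1 k : ℂ)) F)

/-- A function on a subset `Z` of `𝔾_m² × ℙ²` is regular if, near every point of `Z`, it is the
quotient of two polynomials in `t` and `v` that are homogeneous of the same degree in `v`. -/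
def IsRegularPair {Z : Set (Torus × DualPlane)} (f : Z → ℂ) : Prop :=
  ∀ z : Z, ∃ (d : ℕ) (F G : MvPolynomial (Fin 3) (MvPolynomial (Fin 2) ℂ)),
    F.IsHomogeneous d ∧ G.IsHomogeneous d ∧ evalPair z.1 G ≠ 0 ∧
    ∀ w : Z, evalPair w.1 G ≠ 0 → f w = evalPair w.1 F / evalPair w.1 G

/-! ### Algebraic vector bundles -/

/-- An algebraic vector bundle on the dual plane: a family of complex vector spaces with
trivializations over the members of a Zariski open cover, whose transition matrices have regular
entries. -/
structure VBundle where
  /-- the rank -/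
  rank : ℕ
  /-- the fibre at a point -/
  fiber : DualPlane → Type
  [addCommGroup : ∀ p, AddCommGroup (fiber p)]
  [module : ∀ p, Module ℂ (fiber p)]
  /-- the index set of the cover -/
  chart : Type
  /-- the members of the cover -/
  dom : chart → Set DualPlane
  isOpen_dom : ∀ i, IsZariskiOpen (dom i)
  cover : ∀ p, ∃ i, p ∈ dom i
  /-- the local trivializations -/
  triv : ∀ i (p : dom i), fiber p ≃ₗ[ℂ] (Fin rank → ℂ)
  transition : ∀ i j a b, IsRegular (Z := dom i ∩ dom j)
    (fun p => triv j ⟨p, p.2.2⟩ ((triv i ⟨p, p.2.1⟩).symm (Pi.single a 1)) b)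

attribute [instance] VBundle.addCommGroup VBundle.module

/-- A fibrewise linear map of vector bundles is regular if its matrix entries in the local
trivializations are regular functions. -/
def VBundle.IsRegularMap (E E' : VBundle) (f : ∀ p, E.fiber p →ₗ[ℂ] E'.fiber p) : Prop :=
  ∀ i j a b, IsRegular (Z := E.dom i ∩ E'.dom j)
    (fun p => E'.triv j ⟨p, p.2.2⟩ (f p ((E.triv i ⟨p, p.2.1⟩).symm (Pi.single a 1))) b)

/-- The bundle `E` is trivial on the subvariety `Z`: there is a regular isomorphism over `Z` from
the trivial bundle `Z × ℂ^r` to the restriction of `E`. -/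
def VBundle.TrivialOn (E : VBundle) (Z : Set DualPlane) : Prop :=
  ∃ e : ∀ p : Z, (Fin E.rank → ℂ) ≃ₗ[ℂ] E.fiber p,
    ∀ i a b, IsRegular (Z := Z ∩ E.dom i)
      (fun p => E.triv i ⟨p, p.2.2⟩ (e ⟨p, p.2.1⟩ (Pi.single a 1)) b)

/-- A `𝔾_m²`-equivariant vector bundle on the dual plane: a vector bundle with an action of the
torus on its total space that covers the action on the base, is linear on the fibres, and is
algebraic. Here `act t h` is the action of `t` from the fibre at `p` to the fibre at `q = t • p`. -/
structure EquivBundle extends VBundle where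
  /-- the action of the torus -/
  act : ∀ (t : Torus) {p q : DualPlane}, t • p = q → (fiber p →ₗ[ℂ] fiber q)
  act_one : ∀ (p : DualPlane) (h : (1 : Torus) • p = p) (x : fiber p), act 1 h x = x
  act_mul : ∀ (s t : Torus) {p q r : DualPlane} (h : t • p = q) (h' : s • q = r)
    (h'' : (s * t) • p = r) (x : fiber p), act (s * t) h'' x = act s h' (act t h x)
  act_regular : ∀ i j a b,
    IsRegularPair (Z := {z : Torus × DualPlane | z.2 ∈ dom i ∧ z.1 • z.2 ∈ dom j})
      (fun z => triv j ⟨z.1.1 • z.1.2, z.2.2⟩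
        (act z.1.1 rfl ((triv i ⟨z.1.2, z.2.1⟩).symm (Pi.single a 1))) b)

/-- A morphism of equivariant bundles: a regular, fibrewise linear map that commutes with the
action of the torus. -/
@[ext]
structure EquivBundle.Hom (E E' : EquivBundle) where
  /-- the linear maps on the fibres -/
  app : ∀ p, E.fiber p →ₗ[ℂ] E'.fiber p
  regular : E.toVBundle.IsRegularMap E'.toVBundle app
  equivariant : ∀ (t : Torus) {p q : DualPlane} (h : t • p = q) (x : E.fiber p),
    app q (E.act t h x) = E'.act t h (app p x)

/-! ### Composition of morphisms -/

/-- Regularity at one point. -/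
def IsRegularAt {Z : Set DualPlane} (f : Z → ℂ) (p : DualPlane) : Prop :=
  ∃ (d : ℕ) (F G : MvPolynomial (Fin 3) ℂ), F.IsHomogeneous d ∧ G.IsHomogeneous d ∧
    eval p.rep G ≠ 0 ∧
    ∀ q : Z, eval q.1.rep G ≠ 0 → f q = eval q.1.rep F / eval q.1.rep G

theorem IsRegularAt.zero {Z : Set DualPlane} {p : DualPlane} :
    IsRegularAt (fun _ : Z => (0 : ℂ)) p :=
  ⟨0, 0, 1, isHomogeneous_zero _ _ _, isHomogeneous_one _ _, by simp, by simp⟩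

theorem IsRegularAt.add {Z : Set DualPlane} {p : DualPlane} {f g : Z → ℂ}
    (hf : IsRegularAt f p) (hg : IsRegularAt g p) : IsRegularAt (fun q => f q + g q) p := by
  obtain ⟨d, F, G, hF, hG, h0, h⟩ := hf
  obtain ⟨d', F', G', hF', hG', h0', h'⟩ := hg
  refine ⟨d + d', F * G' + G * F', G * G', (hF.mul hG').add (hG.mul hF'), hG.mul hG', ?_, ?_⟩
  · simpa using ⟨h0, h0'⟩
  · intro q hq
    simp only [map_mul, ne_eq, mul_eq_zero, not_or] at hq
    simp only [h q hq.1, h' q hq.2]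
    rw [div_add_div _ _ hq.1 hq.2]
    simp

theorem IsRegularAt.mul {Z : Set DualPlane} {p : DualPlane} {f g : Z → ℂ}
    (hf : IsRegularAt f p) (hg : IsRegularAt g p) : IsRegularAt (fun q => f q * g q) p := by
  obtain ⟨d, F, G, hF, hG, h0, h⟩ := hf
  obtain ⟨d', F', G', hF', hG', h0', h'⟩ := hg
  refine ⟨d + d', F * F', G * G', hF.mul hF', hG.mul hG', ?_, ?_⟩
  · simpa using ⟨h0, h0'⟩
  · intro q hq
    simp only [map_mul, ne_eq, mul_eq_zero, not_or] at hq
    simp only [h q hq.1, h' q hq.2]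
    rw [div_mul_div_comm]
    simp

theorem IsRegularAt.sum {Z : Set DualPlane} {p : DualPlane} {n : ℕ} {f : Fin n → Z → ℂ}
    (hf : ∀ c, IsRegularAt (f c) p) : IsRegularAt (fun q => ∑ c, f c q) p := by
  classical
  have key : ∀ s : Finset (Fin n), IsRegularAt (fun q => ∑ c ∈ s, f c q) p := by
    intro s
    induction s using Finset.induction_on with
    | empty => simpa using IsRegularAt.zero
    | insert a s ha ih => simpa [Finset.sum_insert ha] using (hf a).add ih
  exact key _

/-- Regularity at a point is not affected by passing to an open neighbourhood. -/
theorem IsRegularAt.of_local {Z Z' U : Set DualPlane} {p : DualPlane} (hU : IsZariskiOpen U)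
    (hp : p ∈ U) {f : Z → ℂ} {g : Z' → ℂ} (hg : IsRegularAt g p)
    (h : ∀ q (hq : q ∈ Z), q ∈ U → ∃ hq' : q ∈ Z', f ⟨q, hq⟩ = g ⟨q, hq'⟩) :
    IsRegularAt f p := by
  obtain ⟨d, F, G, hF, hG, h0, hFG⟩ := hg
  obtain ⟨d', G', hG', h0', hsub⟩ := hU p hp
  refine ⟨d + d', F * G', G * G', hF.mul hG', hG.mul hG', ?_, ?_⟩
  · simpa using ⟨h0, h0'⟩
  · rintro ⟨q, hqZ⟩ hq
    simp only [map_mul, ne_eq, mul_eq_zero, not_or] at hq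
    obtain ⟨hq', e⟩ := h q hqZ (hsub q hq.2)
    rw [e, hFG ⟨q, hq'⟩ hq.1]
    simp only [map_mul]
    rw [mul_div_mul_right _ _ hq.2]

theorem VBundle.IsRegularMap.comp {E E' E'' : VBundle} {f : ∀ p, E.fiber p →ₗ[ℂ] E'.fiber p}
    {g : ∀ p, E'.fiber p →ₗ[ℂ] E''.fiber p} (hg : E'.IsRegularMap E'' g)
    (hf : E.IsRegularMap E' f) : E.IsRegularMap E'' (fun p => (g p).comp (f p)) := by
  rintro i k a b ⟨p, hpi, hpk⟩
  obtain ⟨j, hj⟩ := E'.cover p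
  let Z' : Set DualPlane := E.dom i ∩ E'.dom j ∩ E''.dom k
  let φ : Fin E'.rank → Z' → ℂ := fun c q =>
    E'.triv j ⟨q, q.2.1.2⟩ (f q ((E.triv i ⟨q, q.2.1.1⟩).symm (Pi.single a 1))) c
  let ψ : Fin E'.rank → Z' → ℂ := fun c q =>
    E''.triv k ⟨q, q.2.2⟩ (g q ((E'.triv j ⟨q, q.2.1.2⟩).symm (Pi.single c 1))) b
  have hφ : ∀ c, IsRegularAt (φ c) p := fun c =>
    IsRegularAt.of_local (E'.isOpen_dom j) hj (hf i j a c ⟨p, hpi, hj⟩)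
      (fun q hq _ => ⟨hq.1, rfl⟩)
  have hψ : ∀ c, IsRegularAt (ψ c) p := fun c =>
    IsRegularAt.of_local (E'.isOpen_dom j) hj (hg j k c b ⟨p, hj, hpk⟩)
      (fun q hq _ => ⟨⟨hq.1.2, hq.2⟩, rfl⟩)
  refine IsRegularAt.of_local (E'.isOpen_dom j) hj
    (IsRegularAt.sum fun c => (hφ c).mul (hψ c)) ?_
  intro q hq hqj
  refine ⟨⟨⟨hq.1, hqj⟩, hq.2⟩, ?_⟩
  set y := f q ((E.triv i ⟨q, hq.1⟩).symm (Pi.single a 1)) with hy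
  have hdec : y = ∑ c, (E'.triv j ⟨q, hqj⟩ y c) •
      (E'.triv j ⟨q, hqj⟩).symm (Pi.single c 1) := by
    apply (E'.triv j ⟨q, hqj⟩).injective
    rw [map_sum]
    simp only [map_smul, LinearEquiv.apply_symm_apply]
    ext c'
    simp [Finset.sum_apply, Pi.single_apply]
  change E''.triv k ⟨q, hq.2⟩ (g q y) b = ∑ c, E'.triv j ⟨q, hqj⟩ y c *
    E''.triv k ⟨q, hq.2⟩ (g q ((E'.triv j ⟨q, hqj⟩).symm (Pi.single c 1))) b
  conv_lhs => rw [hdec]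
  simp [map_sum, Finset.sum_apply]

/-! ### The category of equivariant bundles and the categories `𝒫` and `𝒬` -/

/-- The category of `𝔾_m²`-equivariant vector bundles on the dual plane. -/
instance : Category EquivBundle where
  Hom E E' := EquivBundle.Hom E E'
  id E :=
    { app := fun _ => LinearMap.id
      regular := E.transition
      equivariant := fun _ _ _ _ _ => rfl }
  comp f g :=
    { app := fun p => (g.app p).comp (f.app p)
      regular := g.regular.comp f.regular
      equivariant := fun t _ _ h x => by
        simp only [LinearMap.comp_apply, f.equivariant t h, g.equivariant t h] }

/-- The objects of `𝒫`: equivariant bundles that are trivial on the line `ℙ¹_W`. -/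
def IsObjP : ObjectProperty EquivBundle := fun E => E.TrivialOn lineW

/-- The objects of `𝒬`: equivariant bundles that are trivial on each line `λ_x`, `x ∈ 𝔸²`. -/
def IsObjQ : ObjectProperty EquivBundle :=
  fun E => ∀ t : Fin 2 → ℂ, E.TrivialOn (dualLine (affinePoint t))

/-- The morphisms of `𝒫`, among all equivariant morphisms between objects of `𝒫`: those whose
rank is constant on the complement of the point `[1 : 0 : 0]`. -/
def IsMorP : MorphismProperty IsObjP.FullSubcategory := fun _ _ f =>
  ∃ r : ℕ, ∀ p : DualPlane, p ≠ basePoint → Module.finrank ℂ (LinearMap.range (f.hom.app p)) = r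

/-- The category `𝒫`. -/
abbrev CatP [IsMorP.IsMultiplicative] : Type 1 := WideSubcategory IsMorP

/-- The category `𝒬`: the full subcategory of equivariant bundles on the objects of `𝒬`. -/
abbrev CatQ : Type 1 := IsObjQ.FullSubcategory

/-- The inclusion of `𝒫` into the category of all equivariant bundles. -/
abbrev inclP [IsMorP.IsMultiplicative] : CatP ⥤ EquivBundle :=
  wideSubcategoryInclusion IsMorP ⋙ IsObjP.ι

/-- The inclusion of `𝒬` into the category of all equivariant bundles. -/
abbrev inclQ : CatQ ⥤ EquivBundle := IsObjQ.ι

end EquivariantPlane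

end

noncomputable section

namespace EquivariantPlane

section LocalRings

open scoped Polynomial

/-! ### Local rings of the projective line -/

/-! The two categories have the same objects, and every equivariant morphism between these objects
already has constant rank off $[1:0:0]$. The equivalence is therefore the identity on bundles and on
maps (`exists_equivalence_of_isObjQ`).

Morphisms: on $\lambda_x$ both bundles have global frames, in which a morphism is a matrix of
regular functions on a projective line, hence a constant matrix
(`exists_finrank_range_eq_on_dualLine`). The lines $\lambda_x$, $x\in\mathbb A^2$, cover the
complement of $[1:0:0]$ and meet pairwise, so their ranks agree (`isMorP_of_trivialOn`).

Objects: $W=\lambda_0$, so triviality on all $\lambda_x$ gives triviality on $W$. For the converse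
(`isObjQ_of_isObjP`) fix $x$ and take the lines $L_c: v_0+c(x_0v_1+x_1v_2)=0$, with $L_0=W$ and
$L_1=\lambda_x$. The torus element $(c,c)$ carries $L_1$ to $L_c$ for $c\ne 0$. With $c=t$ a formal
variable, the pullback of $E|_{\lambda_x}$ to $\mathbb C((t))$ is thus isomorphic to the family
$E|_{L_t}$, which extends over $\mathbb C[[t]]$ with trivial special fibre $E|_W$. As $H^1(\mathbb
P^1,\mathcal O)=0$, the frame on $W$ extends order by order in $t$ (`exists_formal_frame`), so
$E|_{\lambda_x}$ is trivial over $\mathbb C((t))$. Triviality descends to $\mathbb C$ by comparing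
global sections with this formal frame and using $H^0(\mathbb P^1,\mathcal O)=\mathbb C$
(`exists_global_frame`).

All of this is done with cocycles: a bundle on the line is a family of matrices over $\mathbb C(z)$,
one for each point $p$, considered relative to the local ring at $p$. The relation `Rep` converts
identities between matrices at generic points of the pencil into identities between Laurent series
in $t$ over $\mathbb C(z)$. -/

/-- The affine coordinate, vanishing at the point `p`, on the projective line `Option ℂ`, as a
rational function. -/
def coord : Option ℂ → RatFunc ℂ
  | some b => RatFunc.X - RatFunc.C b
  | none => (RatFunc.X)⁻¹

/-- Identities between polynomials in `coord p` can thereby be lifted to polynomial identities and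
evaluated at 0, which is why values of rational functions are unique. -/
theorem transcendental_coord (p : Option ℂ) : Transcendental ℂ (coord p) := by
  cases p with
  | none =>
    intro h
    exact RatFunc.transcendental_X (K := ℂ) (by simpa [coord] using h.inv)
  | some b =>
    intro h
    refine RatFunc.transcendental_X (K := ℂ) ?_
    have := h.add (isAlgebraic_algebraMap (A := RatFunc ℂ) b)
    simpa [coord, RatFunc.algebraMap_eq_C] using this

theorem aeval_coord_ne_zero (p : Option ℂ) {G : ℂ[X]} (hG : G ≠ 0) :
    Polynomial.aeval (coord p) G ≠ 0 :=
  fun h => hG ((transcendental_iff.1 (transcendental_coord p)) G h)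

theorem coord_ne_zero (p : Option ℂ) : coord p ≠ 0 := by
  simpa using aeval_coord_ne_zero p Polynomial.X_ne_zero

/-- The rational function `f` is regular at `p`, with value `a`. -/
def HasVal (p : Option ℂ) (f : RatFunc ℂ) (a : ℂ) : Prop :=
  ∃ F G : ℂ[X], G.eval 0 ≠ 0 ∧ f * Polynomial.aeval (coord p) G = Polynomial.aeval (coord p) F ∧
    a * G.eval 0 = F.eval 0

theorem ne_zero_of_eval_ne_zero {G : ℂ[X]} {a : ℂ} (h : G.eval a ≠ 0) : G ≠ 0 := by
  rintro rfl
  simp at h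

namespace HasVal

variable {p : Option ℂ} {f g : RatFunc ℂ} {a b : ℂ}

theorem const (p : Option ℂ) (a : ℂ) : HasVal p (algebraMap ℂ _ a) a :=
  ⟨Polynomial.C a, 1, by simp, by simp, by simp⟩

theorem polynomial (p : Option ℂ) (F : ℂ[X]) : HasVal p (Polynomial.aeval (coord p) F) (F.eval 0) :=
  ⟨F, 1, by simp, by simp, by simp⟩

theorem coord (p : Option ℂ) : HasVal p (coord p) 0 := by
  simpa using polynomial p Polynomial.X

theorem add (hf : HasVal p f a) (hg : HasVal p g b) : HasVal p (f + g) (a + b) := by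
  obtain ⟨F, G, h0, h1, h2⟩ := hf
  obtain ⟨F', G', h0', h1', h2'⟩ := hg
  refine ⟨F * G' + F' * G, G * G', by simp [h0, h0'], ?_, ?_⟩
  · simp only [map_add, map_mul, ← h1, ← h1']; ring
  · simp only [Polynomial.eval_add, Polynomial.eval_mul, ← h2, ← h2']; ring

theorem mul (hf : HasVal p f a) (hg : HasVal p g b) : HasVal p (f * g) (a * b) := by
  obtain ⟨F, G, h0, h1, h2⟩ := hf
  obtain ⟨F', G', h0', h1', h2'⟩ := hg
  refine ⟨F * F', G * G', by simp [h0, h0'], ?_, ?_⟩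
  · simp only [map_mul, ← h1, ← h1']; ring
  · simp only [Polynomial.eval_mul, ← h2, ← h2']; ring

theorem inv (hf : HasVal p f a) (ha : a ≠ 0) : HasVal p f⁻¹ a⁻¹ := by
  obtain ⟨F, G, h0, h1, h2⟩ := hf
  have hF : F.eval 0 ≠ 0 := by rw [← h2]; exact mul_ne_zero ha h0
  have hG := aeval_coord_ne_zero p (ne_zero_of_eval_ne_zero h0)
  have hf : f ≠ 0 := by
    rintro rfl
    rw [zero_mul] at h1
    exact aeval_coord_ne_zero p (ne_zero_of_eval_ne_zero hF) h1.symm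
  refine ⟨G, F, hF, ?_, ?_⟩
  · rw [← h1]; field_simp
  · rw [← h2]; field_simp

theorem unique (hf : HasVal p f a) (hf' : HasVal p f b) : a = b := by
  obtain ⟨F, G, h0, h1, h2⟩ := hf
  obtain ⟨F', G', h0', h1', h2'⟩ := hf'
  have key : Polynomial.aeval (EquivariantPlane.coord p) (F * G' - F' * G) = 0 := by
    simp only [map_sub, map_mul, ← h1, ← h1']; ring
  have key' : F * G' - F' * G = 0 := by
    by_contra h
    exact aeval_coord_ne_zero p h key
  have := congrArg (Polynomial.eval 0) key'
  simp only [Polynomial.eval_sub, Polynomial.eval_mul, ← h2, ← h2', Polynomial.eval_zero] at this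
  have : (a - b) * (G.eval 0 * G'.eval 0) = 0 := by linear_combination this
  simpa [h0, h0', sub_eq_zero] using this

end HasVal

/-- The local ring of the projective line at `p`. -/
def localRing (p : Option ℂ) : Subalgebra ℂ (RatFunc ℂ) where
  carrier := {f | ∃ a, HasVal p f a}
  mul_mem' := fun ⟨_, h⟩ ⟨_, h'⟩ => ⟨_, h.mul h'⟩
  add_mem' := fun ⟨_, h⟩ ⟨_, h'⟩ => ⟨_, h.add h'⟩
  algebraMap_mem' a := ⟨a, .const p a⟩

theorem HasVal.mem {p : Option ℂ} {f : RatFunc ℂ} {a : ℂ} (h : HasVal p f a) : f ∈ localRing p :=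
  ⟨a, h⟩

/-- The evaluation at the point `p`. -/
def evalAt (p : Option ℂ) : localRing p →ₐ[ℂ] ℂ where
  toFun f := f.2.choose
  map_one' := (Exists.choose_spec (1 : localRing p).2).unique (by simpa using HasVal.const p 1)
  map_zero' := (Exists.choose_spec (0 : localRing p).2).unique (by simpa using HasVal.const p 0)
  map_mul' f g := (Exists.choose_spec (f * g).2).unique (f.2.choose_spec.mul g.2.choose_spec)
  map_add' f g := (Exists.choose_spec (f + g).2).unique (f.2.choose_spec.add g.2.choose_spec)
  commutes' a := (Exists.choose_spec (algebraMap ℂ (localRing p) a).2).unique (.const p a)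

theorem hasVal_evalAt {p : Option ℂ} (f : localRing p) : HasVal p f (evalAt p f) :=
  f.2.choose_spec

/-- The inverse of the coordinate at `p` has its only pole at `p`. -/
theorem inv_coord_mem {p q : Option ℂ} (h : q ≠ p) : (coord p)⁻¹ ∈ localRing q := by
  cases p with
  | none =>
    cases q with
    | none => exact absurd rfl h
    | some b =>
      have := (HasVal.coord (some b)).add (HasVal.const (some b) b)
      refine HasVal.mem (a := 0 + b) ?_
      simpa [coord, RatFunc.algebraMap_eq_C] using this
  | some a =>
    cases q with
    | none =>
      -- With $u=1/X$ the function $1/(X-a)$ is $u/(1-au)$, and the denominator is 1 at infinity.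
      have h1 : HasVal none (1 - RatFunc.C a * coord none) 1 := by
        have := (HasVal.const none 1).add ((HasVal.const none (-a)).mul (HasVal.coord none))
        simpa [RatFunc.algebraMap_eq_C, sub_eq_add_neg] using this
      have h2 := (HasVal.coord none).mul (h1.inv one_ne_zero)
      have hX : (RatFunc.X : RatFunc ℂ) ≠ 0 := RatFunc.X_ne_zero
      have hXa : (RatFunc.X : RatFunc ℂ) - RatFunc.C a ≠ 0 := coord_ne_zero (some a)
      have : (coord (some a))⁻¹ = coord none * (1 - RatFunc.C a * coord none)⁻¹ := by
        simp only [coord]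
        have : (1 : RatFunc ℂ) - RatFunc.C a * RatFunc.X⁻¹
          = (RatFunc.X - RatFunc.C a) * RatFunc.X⁻¹ := by field_simp
        rw [this]; field_simp
      rw [this]
      exact h2.mem
    | some b =>
      have hba : b - a ≠ 0 := sub_ne_zero.2 fun e => h (by rw [e])
      have h1 : HasVal (some b) (coord (some a)) (b - a) := by
        have := (HasVal.coord (some b)).add (HasVal.const (some b) (b - a))
        simpa [coord, RatFunc.algebraMap_eq_C] using this
      exact (h1.inv hba).mem

/-- A power of the coordinate at `p` cancels the pole of a rational function at `p`. -/
theorem exists_coord_pow_mul_mem (p : Option ℂ) (f : RatFunc ℂ) :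
    ∃ n : ℕ, coord p ^ n * f ∈ localRing p := by
  -- A polynomial in `X` is rewritten in the coordinate at `p`: by translation at a finite point,
  -- and at infinity by reversal, which costs a power of the coordinate.
  have key : ∀ G : ℂ[X], ∃ (n : ℕ) (H : ℂ[X]) , algebraMap ℂ[X] (RatFunc ℂ) G * coord p ^ n
      = Polynomial.aeval (coord p) H ∧ (G ≠ 0 → H ≠ 0) := by
    intro G
    cases p with
    | some b =>
      refine ⟨0, G.comp (Polynomial.X + Polynomial.C b), ?_, fun h h' => h ?_⟩
      · rw [pow_zero, mul_one, Polynomial.aeval_comp]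
        simp [coord, RatFunc.algebraMap_eq_C]
      · have := congrArg (fun F => F.comp (Polynomial.X - Polynomial.C b)) h'
        simpa [Polynomial.comp_assoc] using this
    | none =>
      refine ⟨G.natDegree, G.reverse, ?_, fun h h' => h ?_⟩
      · have hX : (RatFunc.X : RatFunc ℂ) ≠ 0 := RatFunc.X_ne_zero
        let _ := invertibleOfNonzero hX
        have := Polynomial.eval₂_reverse_mul_pow (algebraMap ℂ (RatFunc ℂ))
          (RatFunc.X : RatFunc ℂ) G
        rw [invOf_eq_inv] at this
        simp only [coord, Polynomial.aeval_def]
        have h2 : algebraMap ℂ[X] (RatFunc ℂ) G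
            = Polynomial.eval₂ (algebraMap ℂ (RatFunc ℂ)) RatFunc.X G := by
          rw [← Polynomial.aeval_def, ← RatFunc.algebraMap_X, Polynomial.aeval_algebraMap_apply]
          simp
        rw [h2, ← this, mul_assoc, ← mul_pow, mul_inv_cancel₀ hX]; simp
      · simpa using h'
  obtain ⟨n, H, h1, -⟩ := key f.num
  obtain ⟨m, D, h2, hD⟩ := key f.denom
  have hD0 := hD f.denom_ne_zero
  obtain ⟨D', hD', hD''⟩ := Polynomial.exists_eq_pow_rootMultiplicity_mul_and_not_dvd D hD0 0
  set k := Polynomial.rootMultiplicity 0 D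
  have hD0' : D'.eval 0 ≠ 0 := by
    rw [ne_eq]; rwa [← Polynomial.IsRoot.def, ← Polynomial.dvd_iff_isRoot]
  have hc := coord_ne_zero p
  have hden : algebraMap ℂ[X] (RatFunc ℂ) f.denom ≠ 0 := by
    simpa using f.denom_ne_zero
  have hDD := aeval_coord_ne_zero p (ne_zero_of_eval_ne_zero hD0')
  refine ⟨n + k, _, H * Polynomial.X ^ m, D', hD0', ?_, div_mul_cancel₀ _ hD0'⟩
  have h3 : algebraMap ℂ[X] (RatFunc ℂ) f.denom * coord p ^ m
      = coord p ^ k * Polynomial.aeval (coord p) D' := by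
    rw [h2, hD']; simp
  have h4 := f.num_div_denom
  rw [map_mul, ← h1, map_pow, Polynomial.aeval_X]
  conv_lhs => rw [← h4]
  rw [pow_add]
  field_simp
  linear_combination (- algebraMap ℂ[X] (RatFunc ℂ) f.num) * h3

/-- The principal part at one point. -/
theorem exists_principal_part (p : Option ℂ) (f : RatFunc ℂ) :
    ∃ g : RatFunc ℂ, f - g ∈ localRing p ∧ ∀ q, q ≠ p → g ∈ localRing q := by
  obtain ⟨n, hn⟩ := exists_coord_pow_mul_mem p f
  induction n generalizing f with
  | zero => exact ⟨0, by simpa using hn, fun _ _ => zero_mem _⟩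
  | succ n ih =>
    obtain ⟨a, F, G, h0, h1, h2⟩ := hn
    have hc := coord_ne_zero p
    -- The leading polar term: `a` is the value at `p` of `coord p ^ (n + 1) * f`, so subtracting
    -- `h` lowers the bound on the pole order by one.
    set h : RatFunc ℂ := algebraMap ℂ _ a * (coord p)⁻¹ ^ (n + 1) with hh
    have hdvd : Polynomial.X ∣ F - Polynomial.C a * G := by
      rw [Polynomial.X_dvd_iff, Polynomial.coeff_zero_eq_eval_zero]; simp [h2]
    obtain ⟨F', hF'⟩ := hdvd
    obtain ⟨g, hg, hg'⟩ := ih (f - h) ⟨_, F', G, h0, by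
      have h3 := congrArg (Polynomial.aeval (coord p)) hF'
      simp only [map_sub, map_mul, Polynomial.aeval_C, Polynomial.aeval_X, ← h1] at h3
      have h4 : coord p ^ (n + 1) * h = algebraMap ℂ _ a := by
        rw [hh, mul_left_comm, ← mul_pow, mul_inv_cancel₀ hc, one_pow, mul_one]
      apply mul_left_cancel₀ hc
      rw [← h3]
      linear_combination (-Polynomial.aeval (coord p) G) * h4, div_mul_cancel₀ _ h0⟩
    refine ⟨g + h, by rwa [sub_add_eq_sub_sub_swap], fun q hq => add_mem (hg' q hq) ?_⟩
    exact mul_mem (algebraMap_mem _ a) (pow_mem (inv_coord_mem hq) _)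

/-- Principal parts can be prescribed at finitely many points (`H¹(ℙ¹, 𝒪) = 0`). -/
theorem exists_principal_parts (f : Option ℂ → RatFunc ℂ) (s : Finset (Option ℂ))
    (hs : ∀ p, p ∉ s → f p ∈ localRing p) :
    ∃ g : RatFunc ℂ, ∀ p, f p - g ∈ localRing p := by
  classical
  choose g hg hg' using fun p => exists_principal_part p (f p)
  refine ⟨∑ p ∈ s, g p, fun p => ?_⟩
  by_cases hp : p ∈ s
  · rw [← Finset.add_sum_erase _ _ hp, ← sub_sub]
    exact sub_mem (hg p) (sum_mem fun q hq => hg' q p (Finset.ne_of_mem_erase hq).symm)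
  · exact sub_mem (hs p hp) (sum_mem fun q hq => hg' q p fun e => hp (e ▸ hq))

/-- A rational function that is regular everywhere is constant (`H⁰(ℙ¹, 𝒪) = ℂ`). -/
theorem exists_eq_const_of_forall_mem {f : RatFunc ℂ} (hf : ∀ p, f ∈ localRing p) :
    ∃ a : ℂ, f = algebraMap ℂ _ a := by
  have hinj := IsFractionRing.injective ℂ[X] (RatFunc ℂ)
  -- At a root `b` of the denominator, regularity would make the denominator divide a polynomial
  -- that does not vanish at `b`.
  have hden : f.denom.natDegree = 0 := by
    by_contra h
    obtain ⟨b, hb⟩ := IsAlgClosed.exists_root f.denom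
      (fun h' => h (Polynomial.natDegree_eq_of_degree_eq_some h'))
    obtain ⟨a, F, G, h0, h1, h2⟩ := hf (some b)
    have hc : ∀ P : ℂ[X], Polynomial.aeval (coord (some b)) P
        = algebraMap ℂ[X] (RatFunc ℂ) (P.comp (Polynomial.X - Polynomial.C b)) := by
      intro P
      have : coord (some b) = algebraMap ℂ[X] (RatFunc ℂ) (Polynomial.X - Polynomial.C b) := by
        simp [coord]
      rw [this, Polynomial.aeval_algebraMap_apply, Polynomial.aeval_def, Polynomial.comp]
      rfl
    rw [hc, hc] at h1
    have hd : algebraMap ℂ[X] (RatFunc ℂ) f.denom ≠ 0 := by simpa using f.denom_ne_zero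
    rw [← f.num_div_denom, div_mul_eq_mul_div, div_eq_iff hd, ← map_mul, ← map_mul] at h1
    have h3 := f.isCoprime_num_denom.symm.dvd_of_dvd_mul_left ⟨_, (hinj h1).trans (mul_comm _ _)⟩
    have h4 : (G.comp (Polynomial.X - Polynomial.C b)).eval b = 0 := by
      obtain ⟨R, hR⟩ := h3
      rw [hR, Polynomial.eval_mul, hb.eq_zero, zero_mul]
    simp at h4
    exact h0 h4
  have hden1 : f.denom = 1 := Polynomial.eq_one_of_monic_natDegree_zero f.monic_denom hden
  have hnum : f = algebraMap ℂ[X] (RatFunc ℂ) f.num := by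
    conv_lhs => rw [← f.num_div_denom, hden1, map_one, div_one]
  set N := f.num
  have hX : (RatFunc.X : RatFunc ℂ) ≠ 0 := RatFunc.X_ne_zero
  let _ := invertibleOfNonzero hX
  have hrev := Polynomial.eval₂_reverse_mul_pow (algebraMap ℂ (RatFunc ℂ)) (RatFunc.X : RatFunc ℂ) N
  rw [invOf_eq_inv, ← Polynomial.aeval_def, ← Polynomial.aeval_def] at hrev
  have hN : algebraMap ℂ[X] (RatFunc ℂ) N = Polynomial.aeval RatFunc.X N := by
    rw [← RatFunc.algebraMap_X, Polynomial.aeval_algebraMap_apply]; simp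
  obtain ⟨a, F, G, h0, h1, h2⟩ := hf none
  -- Regularity at infinity, written in $1/X$. At 0 the left factor is the leading coefficient of
  -- `N` times `G.eval 0 ≠ 0`, so the power of the variable on the right must be trivial.
  have h3 : Polynomial.aeval (coord none) (N.reverse * G)
      = Polynomial.aeval (coord none) (F * Polynomial.X ^ N.natDegree) := by
    rw [map_mul, map_mul, ← h1, hnum, hN, ← hrev, map_pow, Polynomial.aeval_X]
    simp only [coord]
    have : (RatFunc.X : RatFunc ℂ) ^ N.natDegree * RatFunc.X⁻¹ ^ N.natDegree = 1 := by
      rw [← mul_pow, mul_inv_cancel₀ hX, one_pow]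
    linear_combination (-Polynomial.aeval (RatFunc.X : RatFunc ℂ)⁻¹ N.reverse
      * Polynomial.aeval (RatFunc.X : RatFunc ℂ)⁻¹ G) * this
  have h4 : N.reverse * G = F * Polynomial.X ^ N.natDegree := by
    by_contra h
    exact aeval_coord_ne_zero none (sub_ne_zero.2 h) (by rw [map_sub, h3, sub_self])
  by_cases hN0 : N.natDegree = 0
  · obtain ⟨c, hc⟩ := Polynomial.natDegree_eq_zero.1 hN0
    refine ⟨c, ?_⟩
    rw [hnum, ← hc, IsScalarTower.algebraMap_apply ℂ ℂ[X] (RatFunc ℂ)]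
    rfl
  · have h5 := congrArg (Polynomial.eval 0) h4
    rw [Polynomial.eval_mul, ← Polynomial.coeff_zero_eq_eval_zero N.reverse,
      Polynomial.coeff_zero_reverse] at h5
    simp [hN0, h0] at h5
    exact absurd (by simp [h5]) hN0

end LocalRings

/-! ### Matrices of power series and of Laurent series over a subring -/

section Series

variable {K : Type*} [Field K]

/-- The Laurent series whose coefficients lie in the subring `O`. -/
def laurentSubring (O : Subring K) : Subring (LaurentSeries K) where
  carrier := {φ | ∀ n, φ.coeff n ∈ O}
  mul_mem' hf hg n := by
    rw [HahnSeries.coeff_mul]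
    exact sum_mem fun _ _ => mul_mem (hf _) (hg _)
  one_mem' n := by
    rw [HahnSeries.coeff_one]
    split_ifs
    exacts [one_mem _, zero_mem _]
  add_mem' hf hg n := add_mem (hf n) (hg n)
  zero_mem' _ := zero_mem _
  neg_mem' hf n := neg_mem (hf n)

/-- The power series whose coefficients lie in the subring `O`. -/
def powerSeriesSubring (O : Subring K) : Subring (PowerSeries K) where
  carrier := {φ | ∀ n, PowerSeries.coeff n φ ∈ O}
  mul_mem' hf hg n := by
    rw [PowerSeries.coeff_mul]
    exact sum_mem fun _ _ => mul_mem (hf _) (hg _)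
  one_mem' n := by
    rw [PowerSeries.coeff_one]
    split_ifs
    exacts [one_mem _, zero_mem _]
  add_mem' hf hg n := by
    rw [map_add]
    exact add_mem (hf n) (hg n)
  zero_mem' n := by
    rw [map_zero]
    exact zero_mem _
  neg_mem' hf n := by
    rw [map_neg]
    exact neg_mem (hf n)

theorem ofPowerSeries_mem_laurentSubring {O : Subring K} {φ : PowerSeries K}
    (h : φ ∈ powerSeriesSubring O) : HahnSeries.ofPowerSeries ℤ K φ ∈ laurentSubring O := by
  intro n
  rw [PowerSeries.coeff_coe]
  split_ifs
  exacts [zero_mem _, h _]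

theorem C_mem_laurentSubring {O : Subring K} {a : K} (h : a ∈ O) :
    (HahnSeries.C a : LaurentSeries K) ∈ laurentSubring O := by
  intro n
  rw [HahnSeries.C_apply, HahnSeries.coeff_single]
  split_ifs
  exacts [h, zero_mem _]

theorem exists_lift_powerSeries {O : Subring K} {φ : PowerSeries K}
    (h : φ ∈ powerSeriesSubring O) : ∃ ψ : PowerSeries O, PowerSeries.map O.subtype ψ = φ :=
  ⟨PowerSeries.mk fun n => ⟨_, h n⟩, by ext n; simp⟩

theorem map_mem_powerSeriesSubring {O : Subring K} (ψ : PowerSeries O) :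
    PowerSeries.map O.subtype ψ ∈ powerSeriesSubring O := fun n => by simp

/-- A matrix of power series that is the identity modulo `X` is invertible. -/
theorem exists_inverse_of_constantCoeff_eq_one {O : Subring K} {r : ℕ}
    {Z : Matrix (Fin r) (Fin r) (PowerSeries K)} (hZ : Z ∈ (powerSeriesSubring O).matrix)
    (h1 : Z.map PowerSeries.constantCoeff = 1) :
    ∃ Z' ∈ (powerSeriesSubring O).matrix, Z * Z' = 1 := by
  -- Over `O` itself the determinant has constant coefficient 1, hence is a unit, so the inverse
  -- also has coefficients in `O`.
  choose Zl hZl using fun a b => exists_lift_powerSeries (hZ a b)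
  let W : Matrix (Fin r) (Fin r) (PowerSeries O) := Matrix.of Zl
  have hW : (PowerSeries.map O.subtype).mapMatrix W = Z := by
    ext1 a b
    simp [W, hZl]
  have hc : (PowerSeries.constantCoeff (R := O)).mapMatrix W = 1 := by
    ext a b
    have := congrFun (congrFun h1 a) b
    rw [Matrix.map_apply, ← hZl a b] at this
    simp only [RingHom.mapMatrix_apply, Matrix.map_apply, W, Matrix.of_apply]
    rw [← PowerSeries.coeff_zero_eq_constantCoeff_apply, PowerSeries.coeff_map,
      PowerSeries.coeff_zero_eq_constantCoeff_apply] at this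
    refine (O.subtype_apply _).symm.trans (this.trans ?_)
    by_cases hab : a = b
    · rw [hab, Matrix.one_apply_eq, Matrix.one_apply_eq, OneMemClass.coe_one]
    · rw [Matrix.one_apply_ne hab, Matrix.one_apply_ne hab, ZeroMemClass.coe_zero]
  have hu : IsUnit W.det := by
    rw [PowerSeries.isUnit_iff_constantCoeff, RingHom.map_det, hc, Matrix.det_one]
    exact isUnit_one
  refine ⟨(PowerSeries.map O.subtype).mapMatrix W⁻¹, fun a b => map_mem_powerSeriesSubring _, ?_⟩
  rw [← hW, ← map_mul, Matrix.mul_nonsing_inv _ hu, map_one]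

end Series

/-- Constant matrices as matrices of Laurent series. -/
abbrev laurentConst {r : ℕ} : Matrix (Fin r) (Fin r) (RatFunc ℂ) →+*
    Matrix (Fin r) (Fin r) (LaurentSeries (RatFunc ℂ)) :=
  HahnSeries.C.mapMatrix

/-! ### Deformation and descent of trivializations on the projective line -/

/-- Finitely many nontrivial power series matrices that are `1` modulo the variable can be made
regular at all points by one common right factor. -/
theorem exists_formal_frame {r : ℕ}
    (Y : Option ℂ → Matrix (Fin r) (Fin r) (PowerSeries (RatFunc ℂ)))
    (h0 : ∀ p, (Y p).map PowerSeries.constantCoeff = 1) (s : Finset (Option ℂ))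
    (hs : ∀ p, p ∉ s → Y p = 1) :
    ∃ X : Matrix (Fin r) (Fin r) (PowerSeries (RatFunc ℂ)),
      X.map PowerSeries.constantCoeff = 1 ∧
      ∀ p, Y p * X ∈ (powerSeriesSubring (localRing p).toSubring).matrix := by
  -- The condition on `f` stands inside the existential so that `choose` yields a total function,
  -- available to the recursion before the condition is verified.
  have hPP : ∀ f : Option ℂ → Matrix (Fin r) (Fin r) (RatFunc ℂ),
      ∃ g : Matrix (Fin r) (Fin r) (RatFunc ℂ),
      (∀ p, p ∉ s → f p = 0) → ∀ p a b, f p a b - g a b ∈ localRing p := by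
    intro f
    by_cases hf : ∀ p, p ∉ s → f p = 0
    · choose g hg using fun a b => exists_principal_parts (fun p => f p a b) s
        (fun p hp => by rw [hf p hp]; exact zero_mem _)
      exact ⟨Matrix.of g, fun _ p a b => hg a b p⟩
    · exact ⟨0, fun h => absurd h hf⟩
  choose PP hPP using hPP
  let Yc : Option ℂ → ℕ → Matrix (Fin r) (Fin r) (RatFunc ℂ) :=
    fun p n => (Y p).map (PowerSeries.coeff n)
  -- As `Y p` is 1 modulo the variable, the `n`-th coefficient of `Y p * X` is `Xc n` plus a sum
  -- over earlier coefficients. `Xc n` is chosen to cancel the principal part of that sum at every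
  -- point simultaneously.
  let Xc : ℕ → Matrix (Fin r) (Fin r) (RatFunc ℂ) := Nat.lt_wfRel.wf.fix fun n ih =>
    if n = 0 then 1 else PP fun p => -∑ i : Fin n, Yc p (n - i) * ih i i.2
  have hX : ∀ n, Xc n = if n = 0 then 1 else PP fun p => -∑ i : Fin n, Yc p (n - i) * Xc i :=
    fun n => Nat.lt_wfRel.wf.fix_eq _ n
  let X : Matrix (Fin r) (Fin r) (PowerSeries (RatFunc ℂ)) :=
    Matrix.of fun a b => PowerSeries.mk fun n => Xc n a b
  have hYX : ∀ p n, (Y p * X).map (PowerSeries.coeff n)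
      = Xc n + ∑ i : Fin n, Yc p (n - i) * Xc i := by
    intro p n
    have h1 : Yc p 0 = 1 := by
      rw [← h0 p]
      ext1 a b
      simp [Yc]
    have : Xc n + ∑ i : Fin n, Yc p (n - i) * Xc i
        = ∑ i ∈ Finset.range (n + 1), Yc p (n - i) * Xc i := by
      rw [Finset.sum_range_succ, add_comm, Nat.sub_self, h1, one_mul,
        Finset.sum_range (fun i => Yc p (n - i) * Xc i)]
    rw [this]
    ext a b
    have h2 : ∀ j, PowerSeries.coeff n (Y p a j * X j b)
        = ∑ k ∈ Finset.range (n + 1), Yc p (n - k) a j * Xc k j b := by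
      intro j
      rw [PowerSeries.coeff_mul, ← Finset.Nat.sum_antidiagonal_swap,
        Finset.Nat.sum_antidiagonal_eq_sum_range_succ_mk]
      simp [X, Yc]
    rw [Matrix.sum_apply]
    simp only [Matrix.map_apply, Matrix.mul_apply, map_sum, h2]
    exact Finset.sum_comm
  refine ⟨X, ?_, fun p a b n => ?_⟩
  · ext a b
    have := congrFun (congrFun (hX 0) a) b
    simpa [X] using this
  · change ((Y p * X).map (PowerSeries.coeff n)) a b ∈ localRing p
    rw [hYX]
    rcases Nat.eq_zero_or_pos n with rfl | hn
    · rw [hX]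
      by_cases hab : a = b
      · simp [hab, one_mem]
      · simp [hab, zero_mem]
    · have hn' := hX n
      rw [if_neg hn.ne'] at hn'
      have := hPP (fun p => -∑ i : Fin n, Yc p (n - i) * Xc i) (fun p hp => by
        rw [neg_eq_zero]
        refine Finset.sum_eq_zero fun i _ => ?_
        -- Off `s` only the constant coefficient of `Y p` survives, and `n - i` is positive.
        have : Yc p (n - i) = 0 := by
          ext a b
          have h3 : n - (i : ℕ) ≠ 0 := (Nat.sub_pos_of_lt i.2).ne'
          by_cases hab : a = b
          · simp [Yc, hs p hp, hab, PowerSeries.coeff_one, h3]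
          · simp [Yc, hs p hp, hab]
        rw [this, zero_mul]) p a b
      rw [← hn'] at this
      have := neg_mem this
      simpa [add_comm] using this

/-- A bundle on the projective line that becomes trivial over `ℂ((t))` is trivial. -/
theorem exists_global_frame {r : ℕ} (T T' : Option ℂ → Matrix (Fin r) (Fin r) (RatFunc ℂ))
    (hT : ∀ p, T' p * T p = 1) (D D' : Matrix (Fin r) (Fin r) (LaurentSeries (RatFunc ℂ)))
    (hD : D' * D = 1)
    (hmem : ∀ p, D * laurentConst (T' p) ∈
      (laurentSubring (localRing p).toSubring).matrix)
    (hmem' : ∀ p, laurentConst (T p) * D' ∈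
      (laurentSubring (localRing p).toSubring).matrix) :
    ∃ (S : Matrix (Fin r) (Fin r) (RatFunc ℂ)) (v : Option ℂ → Matrix (Fin r) (Fin r) ℂ),
      (∀ p a b, HasVal p ((T p * S) a b) (v p a b)) ∧ ∀ p, IsUnit (v p) := by
  -- The global sections, in coordinates of a generic frame; `T p` passes to a frame near `p`.
  let Γ : Submodule ℂ (Fin r → RatFunc ℂ) :=
    { carrier := {a | ∀ p i, (T p).mulVec a i ∈ localRing p}
      add_mem' := fun ha hb p i => by
        rw [Matrix.mulVec_add]
        exact add_mem (ha p i) (hb p i)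
      zero_mem' := fun p i => by
        rw [Matrix.mulVec_zero]
        exact zero_mem _
      smul_mem' := fun c a ha p i => by
        rw [Matrix.mulVec_smul]
        exact Subalgebra.smul_mem _ (ha p i) c }
  let ev : ∀ p, Γ →ₗ[ℂ] (Fin r → ℂ) := fun p =>
    { toFun := fun a i => evalAt p ⟨_, a.2 p i⟩
      map_add' := fun a b => by
        ext i
        rw [Pi.add_apply, ← map_add]
        congr 2
        exact congrFun (Matrix.mulVec_add _ _ _) i
      map_smul' := fun c a => by
        ext i
        rw [Pi.smul_apply, RingHom.id_apply, ← map_smul]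
        congr 2
        exact congrFun (Matrix.mulVec_smul _ _ _) i }
  have hev : ∀ p (a : Γ) i, HasVal p ((T p).mulVec a i) (ev p a i) :=
    fun p a i => hasVal_evalAt ⟨_, a.2 p i⟩
  -- In the formal frame `D` a section has coefficients that are regular everywhere, hence constant.
  -- If it vanishes at one point, these constants are 0, and `D` is injective.
  have hinj : ∀ p, Function.Injective (ev p) := by
    intro p
    rw [← LinearMap.ker_eq_bot, LinearMap.ker_eq_bot']
    intro a ha
    let c : Fin r → LaurentSeries (RatFunc ℂ) := fun i => HahnSeries.C (a.1 i)
    have hσ : ∀ q i n, (D.mulVec c i).coeff n = ∑ j,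
        ((D * laurentConst (T' q)) i j).coeff n * (T q).mulVec a j := by
      intro q i n
      have h1 : D.mulVec c = (D * laurentConst (T' q)).mulVec
          (fun j => HahnSeries.C ((T q).mulVec a j)) := by
        have h2 : (fun j => (HahnSeries.C ((T q).mulVec a j) : LaurentSeries (RatFunc ℂ)))
            = (laurentConst (T q)).mulVec c := by
          ext1 j
          simp [Matrix.mulVec, dotProduct, c]
        rw [h2, Matrix.mulVec_mulVec, mul_assoc, ← map_mul, hT, map_one, mul_one]
      rw [h1, Matrix.mulVec, dotProduct, HahnSeries.coeff_sum]
      refine Finset.sum_congr rfl fun j _ => ?_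
      rw [mul_comm, HahnSeries.C_mul_eq_smul, HahnSeries.coeff_smul, smul_eq_mul, mul_comm]
    have hσ0 : D.mulVec c = 0 := by
      ext i n
      obtain ⟨z, hz⟩ := exists_eq_const_of_forall_mem (f := (D.mulVec c i).coeff n) fun q => by
        rw [hσ q]
        exact sum_mem fun j _ => mul_mem (hmem q i j n) (a.2 q j)
      have h3 : HasVal p ((D.mulVec c i).coeff n) 0 := by
        rw [hσ p]
        have : ∀ t : Finset (Fin r), HasVal p (∑ j ∈ t,
            ((D * laurentConst (T' p)) i j).coeff n * (T p).mulVec a j) 0 := by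
          intro t
          induction t using Finset.induction_on with
          | empty => simpa using HasVal.const p 0
          | insert j t hj ih =>
            rw [Finset.sum_insert hj]
            obtain ⟨w, hw⟩ := hmem p i j n
            have h4 := hev p a j
            rw [ha] at h4
            simpa using (hw.mul h4).add ih
        exact this _
      rw [hz] at h3 ⊢
      rw [(HasVal.const p z).unique h3]
      simp
    have hc : c = 0 := by
      rw [← Matrix.one_mulVec c, ← hD, ← Matrix.mulVec_mulVec, hσ0, Matrix.mulVec_zero]
    ext i
    exact HahnSeries.C_injective ((congrFun hc i).trans (map_zero _).symm)
  -- The coefficients of the columns of `D'` are global sections. A linear form that kills all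
  -- values of sections at infinity kills every coefficient of `T none * D'` there; multiplying by
  -- the inverse `D * T' none`, whose coefficients are regular at infinity, shows that the form is
  -- 0.
  have hsurj : Function.Surjective (ev none) := by
    rw [← LinearMap.range_eq_top]
    by_contra hlt
    obtain ⟨ℓ, hℓ, hle⟩ := Submodule.exists_le_ker_of_lt_top _ (lt_top_iff_ne_top.2 hlt)
    refine hℓ (LinearMap.pi_ext' fun b => LinearMap.ext_ring ?_)
    simp only [LinearMap.comp_apply, LinearMap.zero_apply, LinearMap.single_apply]
    set lc : Fin r → ℂ := fun i => ℓ (Pi.single i 1) with hlc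
    have hℓv : ∀ v, ℓ v = ∑ i, lc i * v i := by
      intro v
      conv_lhs => rw [← Finset.univ_sum_single v]
      rw [map_sum]
      refine Finset.sum_congr rfl fun i _ => ?_
      have : Pi.single i (v i) = v i • (Pi.single i 1 : Fin r → ℂ) := by
        rw [← Pi.single_smul, smul_eq_mul, mul_one]
      rw [this, map_smul, smul_eq_mul, mul_comm]
    have hcol : ∀ k j, HasVal none
        (∑ i, algebraMap ℂ (RatFunc ℂ) (lc i) *
          ((laurentConst (T none) * D') i j).coeff k) 0 := by
      intro k j
      have hT1 : ∀ q i, (T q).mulVec (fun i => (D' i j).coeff k) i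
          = ((laurentConst (T q) * D') i j).coeff k := by
        intro q i
        rw [Matrix.mul_apply, HahnSeries.coeff_sum, Matrix.mulVec, dotProduct]
        refine Finset.sum_congr rfl fun m _ => ?_
        rw [RingHom.mapMatrix_apply, Matrix.map_apply, HahnSeries.C_mul_eq_smul,
          HahnSeries.coeff_smul, smul_eq_mul]
      let a : Γ := ⟨fun i => (D' i j).coeff k, fun q i => by
        rw [hT1]
        exact hmem' q i j k⟩
      have h0 : ∑ i, lc i * ev none a i = 0 := by
        rw [← hℓv]
        exact hle ⟨a, rfl⟩
      rw [← h0]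
      have : ∀ t : Finset (Fin r), HasVal none (∑ i ∈ t, algebraMap ℂ (RatFunc ℂ) (lc i) *
          ((laurentConst (T none) * D') i j).coeff k) (∑ i ∈ t, lc i * ev none a i) := by
        intro t
        induction t using Finset.induction_on with
        | empty => simpa using HasVal.const none 0
        | insert i t hi ih =>
          rw [Finset.sum_insert hi, Finset.sum_insert hi]
          refine HasVal.add ((HasVal.const _ _).mul ?_) ih
          rw [← hT1]
          exact hev none a i
      exact this _
    let θ : Fin r → LaurentSeries (RatFunc ℂ) := fun j =>
      ∑ i, HahnSeries.C (algebraMap ℂ (RatFunc ℂ) (lc i)) *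
        (laurentConst (T none) * D') i j
    have hθ : ∀ j k, HasVal none ((θ j).coeff k) 0 := by
      intro j k
      convert hcol k j
      simp only [θ, HahnSeries.coeff_sum, HahnSeries.C_mul_eq_smul, HahnSeries.coeff_smul,
        smul_eq_mul]
    have hprod : ∑ j, θ j * (D * laurentConst (T' none)) j b
        = HahnSeries.C (algebraMap ℂ (RatFunc ℂ) (lc b)) := by
      have h1 : laurentConst (T none) * D' * (D * laurentConst (T' none)) = 1 := by
        rw [mul_assoc, ← mul_assoc D', hD, one_mul, ← map_mul, mul_eq_one_comm.1 (hT none), map_one]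
      have h2 : ∀ i, ∑ j, (laurentConst (T none) * D') i j *
          (D * laurentConst (T' none)) j b
          = (1 : Matrix (Fin r) (Fin r) (LaurentSeries (RatFunc ℂ))) i b := by
        intro i
        rw [← h1]
        rfl
      simp only [θ, Finset.sum_mul]
      rw [Finset.sum_comm]
      simp only [mul_assoc, ← Finset.mul_sum, h2]
      simp [Matrix.one_apply]
    have h3 : HasVal none ((∑ j, θ j * (D * laurentConst (T' none)) j b).coeff 0) 0 := by
      rw [HahnSeries.coeff_sum]
      have hsum : ∀ {ι : Type} (t : Finset ι) (f : ι → RatFunc ℂ),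
          (∀ i ∈ t, HasVal none (f i) 0) → HasVal none (∑ i ∈ t, f i) 0 := by
        intro ι t f
        classical
        induction t using Finset.induction_on with
        | empty => exact fun _ => by simpa using HasVal.const none 0
        | insert i t hi ih =>
          intro h
          rw [Finset.sum_insert hi]
          simpa using (h i (Finset.mem_insert_self _ _)).add
            (ih fun j hj => h j (Finset.mem_insert_of_mem hj))
      refine hsum _ _ fun j _ => ?_
      rw [HahnSeries.coeff_mul]
      refine hsum _ _ fun k _ => ?_
      obtain ⟨w, hw⟩ := hmem none j b k.2
      simpa using (hθ j k.1).mul hw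
    rw [hprod, HahnSeries.C_apply, HahnSeries.coeff_single_same] at h3
    exact (HasVal.const none (lc b)).unique h3
  -- Now `Γ` has dimension `r`, so injectivity of evaluation at each other point makes the values of
  -- a basis of `Γ` invertible there as well.
  let E := LinearEquiv.ofBijective (ev none) ⟨hinj none, hsurj⟩
  refine ⟨Matrix.of fun i b => (E.symm (Pi.single b 1)).1 i,
    fun p => Matrix.of fun i b => ev p (E.symm (Pi.single b 1)) i, fun p a b => ?_, fun p => ?_⟩
  · exact hev p (E.symm (Pi.single b 1)) a
  · have : (Matrix.of fun i b => ev p (E.symm (Pi.single b 1)) i)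
        = LinearMap.toMatrix' (ev p ∘ₗ E.symm.toLinearMap) := by
      ext i b
      simp [LinearMap.toMatrix'_apply]
    change IsUnit (Matrix.of fun i b => ev p (E.symm (Pi.single b 1)) i)
    rw [this, ← Matrix.mulVec_injective_iff_isUnit]
    intro x y hxy
    rw [← Matrix.toLin'_apply, ← Matrix.toLin'_apply, Matrix.toLin'_toMatrix'] at hxy
    exact E.symm.injective (hinj p hxy)

/-- The algebraic form of the deformation argument: a bundle on the projective line whose pullback
to `ℂ((t))` extends over `ℂ[[t]]` with trivial special fibre is trivial. -/
theorem exists_global_frame_of_formal {r : ℕ}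
    {e e' T T' : Option ℂ → Matrix (Fin r) (Fin r) (RatFunc ℂ)}
    {e0 e0' : Matrix (Fin r) (Fin r) (RatFunc ℂ)}
    {A A' : Option ℂ → Matrix (Fin r) (Fin r) (LaurentSeries (RatFunc ℂ))}
    {A0 A0' : Matrix (Fin r) (Fin r) (LaurentSeries (RatFunc ℂ))}
    {Q : Option ℂ → Matrix (Fin r) (Fin r) (PowerSeries (RatFunc ℂ))}
    (he : ∀ p, e p * e' p = 1) (he0 : e0 * e0' = 1) (hT : ∀ p, T' p * T p = 1)
    (hA : ∀ p, A p * A' p = 1) (hA0 : A0 * A0' = 1)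
    (hem : ∀ p, e p ∈ (localRing p).toSubring.matrix)
    (hem' : ∀ p, e' p ∈ (localRing p).toSubring.matrix)
    (hAm : ∀ p, A p ∈ (laurentSubring (localRing p).toSubring).matrix)
    (hAm' : ∀ p, A' p ∈ (laurentSubring (localRing p).toSubring).matrix)
    (hAT : ∀ p, A p * laurentConst (T p)
      = (HahnSeries.ofPowerSeries ℤ (RatFunc ℂ)).mapMatrix (Q p) * A0)
    (hQ : ∀ p, (Q p).map PowerSeries.constantCoeff * e0 = e p)
    (s : Finset (Option ℂ)) (hs : ∀ p, p ∉ s → Q p = 1) :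
    ∃ (S : Matrix (Fin r) (Fin r) (RatFunc ℂ)) (v : Option ℂ → Matrix (Fin r) (Fin r) ℂ),
      (∀ p a b, HasVal p ((T p * S) a b) (v p a b)) ∧ ∀ p, IsUnit (v p) := by
  let κ : Matrix (Fin r) (Fin r) (PowerSeries (RatFunc ℂ)) →+*
    Matrix (Fin r) (Fin r) (LaurentSeries (RatFunc ℂ)) :=
    (HahnSeries.ofPowerSeries ℤ (RatFunc ℂ)).mapMatrix
  let c : Matrix (Fin r) (Fin r) (RatFunc ℂ) →+*
    Matrix (Fin r) (Fin r) (LaurentSeries (RatFunc ℂ)) := laurentConst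
  let d : Matrix (Fin r) (Fin r) (RatFunc ℂ) →+*
    Matrix (Fin r) (Fin r) (PowerSeries (RatFunc ℂ)) := PowerSeries.C.mapMatrix
  have hκd : ∀ M, κ (d M) = c M := fun M => by
    ext1 a b
    simp [κ, d, c]
  let cc : Matrix (Fin r) (Fin r) (PowerSeries (RatFunc ℂ)) →+*
    Matrix (Fin r) (Fin r) (RatFunc ℂ) := PowerSeries.constantCoeff.mapMatrix
  have hccd : ∀ M, cc (d M) = M := fun M => by
    ext1 a b
    simp [cc, d]
  have hQ' : ∀ p, cc (Q p) * e0 = e p := hQ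
  have he' := fun p => mul_eq_one_comm.1 (he p)
  -- The matrices `Q p`, rewritten in the frames of the special fibre extended constantly in $t$; by
  -- `hQ` they become 1 at $t=0$.
  obtain ⟨X, hX1, hXm⟩ := exists_formal_frame (fun p => d (e' p) * Q p * d e0) (fun p => by
      change cc (d (e' p) * Q p * d e0) = 1
      rw [map_mul, map_mul, hccd, hccd, mul_assoc, hQ', he']) s (fun p hp => by
      have := hQ' p
      rw [hs p hp, map_one, one_mul] at this
      rw [hs p hp, mul_one, ← map_mul, this, he', map_one])
  obtain ⟨X', -, hXX'⟩ := exists_inverse_of_constantCoeff_eq_one (O := ⊤) (Z := X)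
    (fun _ _ _ => trivial) hX1
  have hX'X := mul_eq_one_comm.1 hXX'
  -- `A0' * c e0 * κ X` is the formal frame of the family, carried back by the inverse of the
  -- action. Near `p` it reads `A' p * e p` times the matrix that `X` has made regular, and its
  -- inverse reads similarly with `A p` and `e' p`.
  refine exists_global_frame T T' hT (κ X' * c e0' * A0) (A0' * c e0 * κ X) ?_ (fun p => ?_)
    (fun p => ?_)
  · calc A0' * c e0 * κ X * (κ X' * c e0' * A0)
        = A0' * c e0 * (κ X * κ X') * c e0' * A0 := by simp only [mul_assoc]
      _ = A0' * (c e0 * c e0') * A0 := by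
        rw [← map_mul, hXX', map_one]; simp only [mul_one, mul_assoc]
      _ = 1 := by rw [← map_mul, he0, map_one, mul_one, mul_eq_one_comm.1 hA0]
  · obtain ⟨Z', hZ'm, hZ'⟩ := exists_inverse_of_constantCoeff_eq_one (hXm p) (by
      change cc (d (e' p) * Q p * d e0 * X) = 1
      have : cc X = 1 := hX1
      rw [map_mul, map_mul, map_mul, hccd, hccd, this, mul_one, mul_assoc, hQ', he'])
    have hZ'1 := mul_eq_one_comm.1 hZ'
    have h1 : Z' * (d (e' p) * Q p) = X' * d e0' := by
      have h2 : Z' * (d (e' p) * Q p) * (d e0 * X) * (X' * d e0') = X' * d e0' := by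
        simp only [← mul_assoc] at hZ'1 ⊢
        rw [hZ'1, one_mul]
      have h3 : d e0 * X * (X' * d e0') = 1 := by
        rw [mul_assoc, ← mul_assoc X, hXX', one_mul, ← map_mul, he0, map_one]
      rw [← h2, mul_assoc (Z' * _), h3, mul_one]
    have h4 : κ X' * c e0' * A0 * c (T' p) = κ Z' * c (e' p) * A p := by
      have h5 : A p = κ (Q p) * A0 * c (T' p) := by
        rw [← hAT p, mul_assoc]
        change _ = A p * (c (T p) * c (T' p))
        rw [← map_mul, mul_eq_one_comm.1 (hT p), map_one, mul_one]
      have h6 := congrArg κ h1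
      simp only [map_mul, hκd] at h6
      rw [← h6, h5]
      simp only [mul_assoc]
    rw [show laurentConst (T' p) = c (T' p) from rfl, h4]
    exact mul_mem (mul_mem (fun a b => ofPowerSeries_mem_laurentSubring (hZ'm a b))
      (fun a b => C_mem_laurentSubring (hem' p a b))) (hAm p)
  · have h1 : c (T p) * A0' = A' p * κ (Q p) := by
      have h2 : A' p * (A p * c (T p)) * A0' = A' p * (κ (Q p) * A0) * A0' := by
        rw [← hAT p]
      rw [← mul_assoc, mul_eq_one_comm.1 (hA p), one_mul] at h2
      rw [h2, mul_assoc, mul_assoc (κ _), hA0, mul_one]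
    have h3 : c (T p) * (A0' * c e0 * κ X)
        = A' p * c (e p) * κ (d (e' p) * Q p * d e0 * X) := by
      simp only [map_mul, hκd]
      have : c (e p) * c (e' p) = 1 := by rw [← map_mul, he, map_one]
      calc c (T p) * (A0' * c e0 * κ X) = c (T p) * A0' * c e0 * κ X := by simp only [mul_assoc]
        _ = A' p * (c (e p) * c (e' p)) * κ (Q p) * c e0 * κ X := by rw [h1, this, mul_one]
        _ = _ := by simp only [mul_assoc]
    rw [show laurentConst (T p) = c (T p) from rfl, h3]
    exact mul_mem (mul_mem (hAm' p) (fun a b => C_mem_laurentSubring (hem p a b)))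
      (fun a b => ofPowerSeries_mem_laurentSubring (hXm p a b))

/-! ### Generic functions of two variables and the Laurent series that represent them -/

/-- The value of the affine coordinate `coord p` at the point with parameter `z`. -/
def coordVal : Option ℂ → ℂ → ℂ
  | some b, z => z - b
  | none, z => z⁻¹

/-- Substitution of the power series variable and of `coord p` in a polynomial. -/
def toPowerSeries (p : Option ℂ) : MvPolynomial (Fin 2) ℂ →ₐ[ℂ] PowerSeries (RatFunc ℂ) :=
  aeval ![PowerSeries.X, PowerSeries.C (coord p)]

/-- Substitution of the Laurent series variable and of `coord p` in a polynomial. -/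
def toLaurent (p : Option ℂ) : MvPolynomial (Fin 2) ℂ →+* LaurentSeries (RatFunc ℂ) :=
  (HahnSeries.ofPowerSeries ℤ (RatFunc ℂ)).comp (toPowerSeries p).toRingHom

theorem toLaurent_apply (p : Option ℂ) (N : MvPolynomial (Fin 2) ℂ) :
    toLaurent p N = HahnSeries.ofPowerSeries ℤ (RatFunc ℂ) (toPowerSeries p N) := rfl

theorem toLaurent_C (p : Option ℂ) (a : ℂ) :
    toLaurent p (C a) = HahnSeries.C (algebraMap ℂ (RatFunc ℂ) a) := by
  rw [toLaurent_apply, toPowerSeries, aeval_C, PowerSeries.algebraMap_apply]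
  exact HahnSeries.ofPowerSeries_C (Γ := ℤ) (algebraMap ℂ (RatFunc ℂ) a)

theorem toLaurent_X_zero (p : Option ℂ) : toLaurent p (X 0) = HahnSeries.single 1 1 := by
  rw [toLaurent_apply, toPowerSeries, aeval_X]
  exact HahnSeries.ofPowerSeries_X

theorem toLaurent_X_one (p : Option ℂ) : toLaurent p (X 1) = HahnSeries.C (coord p) := by
  rw [toLaurent_apply, toPowerSeries, aeval_X]
  exact HahnSeries.ofPowerSeries_C _

/-- The filter of the sets that contain all points outside some curve of the plane. -/
def generic : Filter (ℂ × ℂ) where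
  sets := {s | ∃ G, toLaurent (some 0) G ≠ 0 ∧ ∀ x : ℂ × ℂ, eval ![x.1, x.2] G ≠ 0 → x ∈ s}
  univ_sets := ⟨1, by simp, fun _ _ => trivial⟩
  sets_of_superset := fun ⟨G, hG, h⟩ hst => ⟨G, hG, fun x hx => hst (h x hx)⟩
  inter_sets := fun ⟨G, hG, h⟩ ⟨G', hG', h'⟩ => ⟨G * G', by simp [hG, hG'], fun x hx => by
    rw [map_mul] at hx
    exact ⟨h x (left_ne_zero_of_mul hx), h' x (right_ne_zero_of_mul hx)⟩⟩

theorem eventually_eval_ne_zero {G : MvPolynomial (Fin 2) ℂ} (hG : toLaurent (some 0) G ≠ 0) :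
    ∀ᶠ x in generic, eval ![x.1, x.2] G ≠ 0 :=
  ⟨G, hG, fun _ h => h⟩

/-- If `G` cuts out the exceptional curve, then `N * G` vanishes at every point, so it is the zero
polynomial, and `G ≠ 0`. -/
theorem eq_zero_of_eventually_eval {N : MvPolynomial (Fin 2) ℂ}
    (h : ∀ᶠ x in generic, eval ![x.1, x.2] N = 0) : N = 0 := by
  obtain ⟨G, hG, hN⟩ := h
  have : N * G = 0 := by
    refine MvPolynomial.funext fun x => ?_
    have hx : x = ![x 0, x 1] := by
      ext i
      fin_cases i <;> rfl
    rw [map_mul, map_zero]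
    by_cases h0 : eval x G = 0
    · rw [h0, mul_zero]
    · rw [hx] at h0 ⊢
      rw [show eval ![x 0, x 1] N = 0 from hN (x 0, x 1) h0, zero_mul]
  rcases mul_eq_zero.1 this with h | h
  · exact h
  · rw [h, map_zero] at hG
    exact absurd rfl hG

instance : generic.NeBot := by
  refine ⟨fun h => ?_⟩
  have : (1 : MvPolynomial (Fin 2) ℂ) = 0 := eq_zero_of_eventually_eval (by simp [h])
  exact one_ne_zero this

/-- The Laurent series `φ` represents the generic function `f`. -/
def Rep (φ : LaurentSeries (RatFunc ℂ)) (f : ℂ × ℂ → ℂ) : Prop :=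
  ∃ N G, toLaurent (some 0) G ≠ 0 ∧ φ * toLaurent (some 0) G = toLaurent (some 0) N ∧
    ∀ᶠ x in generic, f x * eval ![x.1, x.2] G = eval ![x.1, x.2] N

namespace Rep

variable {φ ψ : LaurentSeries (RatFunc ℂ)} {f g : ℂ × ℂ → ℂ}

theorem congr (h : Rep φ f) (hfg : ∀ᶠ x in generic, f x = g x) : Rep φ g := by
  obtain ⟨N, G, h0, h1, h2⟩ := h
  refine ⟨N, G, h0, h1, ?_⟩
  filter_upwards [h2, hfg] with x hx hx'
  rw [← hx', hx]

/-- The bridge from pointwise to formal identities: two fractions that agree generically agree after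
cross-multiplication as polynomials, hence as Laurent series. -/
theorem unique (h : Rep φ f) (h' : Rep ψ f) : φ = ψ := by
  obtain ⟨N, G, h0, h1, h2⟩ := h
  obtain ⟨N', G', h0', h1', h2'⟩ := h'
  have key : N * G' - N' * G = 0 := by
    apply eq_zero_of_eventually_eval
    filter_upwards [h2, h2'] with x hx hx'
    simp only [map_sub, map_mul, ← hx, ← hx']
    ring
  have := congrArg (toLaurent (some 0)) key
  simp only [map_sub, map_mul, ← h1, ← h1', map_zero] at this
  have h3 : (φ - ψ) * (toLaurent (some 0) G * toLaurent (some 0) G') = 0 := by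
    linear_combination this
  simpa [h0, h0', sub_eq_zero] using h3

theorem eval (N : MvPolynomial (Fin 2) ℂ) :
    Rep (toLaurent (some 0) N) (fun x => MvPolynomial.eval ![x.1, x.2] N) :=
  ⟨N, 1, by simp, by simp, by simp⟩

theorem add (h : Rep φ f) (h' : Rep ψ g) : Rep (φ + ψ) (fun x => f x + g x) := by
  obtain ⟨N, G, h0, h1, h2⟩ := h
  obtain ⟨N', G', h0', h1', h2'⟩ := h'
  refine ⟨N * G' + N' * G, G * G', by simp [h0, h0'], ?_, ?_⟩
  · simp only [map_add, map_mul, ← h1, ← h1']; ring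
  · filter_upwards [h2, h2'] with x hx hx'
    simp only [map_add, map_mul, ← hx, ← hx']; ring

theorem mul (h : Rep φ f) (h' : Rep ψ g) : Rep (φ * ψ) (fun x => f x * g x) := by
  obtain ⟨N, G, h0, h1, h2⟩ := h
  obtain ⟨N', G', h0', h1', h2'⟩ := h'
  refine ⟨N * N', G * G', by simp [h0, h0'], ?_, ?_⟩
  · simp only [map_mul, ← h1, ← h1']; ring
  · filter_upwards [h2, h2'] with x hx hx'
    simp only [map_mul, ← hx, ← hx']; ring

theorem eventually_ne_zero (h : Rep φ f) (hφ : φ ≠ 0) : ∀ᶠ x in generic, f x ≠ 0 := by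
  obtain ⟨N, G, h0, h1, h2⟩ := h
  have hN : toLaurent (some 0) N ≠ 0 := by
    rw [← h1]
    exact mul_ne_zero hφ h0
  filter_upwards [h2, eventually_eval_ne_zero hN] with x hx hx' h
  rw [h, zero_mul] at hx
  exact hx' hx.symm

theorem inv (h : Rep φ f) (hφ : φ ≠ 0) : Rep φ⁻¹ (fun x => (f x)⁻¹) := by
  have hf := h.eventually_ne_zero hφ
  obtain ⟨N, G, h0, h1, h2⟩ := h
  refine ⟨G, N, ?_, ?_, ?_⟩
  · rw [← h1]
    exact mul_ne_zero hφ h0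
  · rw [← h1]
    rw [← mul_assoc]
    exact (congrArg (· * _) (inv_mul_cancel₀ (G₀ := LaurentSeries (RatFunc ℂ)) hφ)).trans
      (one_mul _)
  · filter_upwards [h2, hf] with x hx hx'
    rw [← hx, inv_mul_cancel_left₀ hx']

theorem const (a : ℂ) : Rep (HahnSeries.C (algebraMap ℂ (RatFunc ℂ) a)) (fun _ => a) := by
  simpa [toLaurent_C] using Rep.eval (C a)

theorem var : Rep (HahnSeries.single 1 1) (fun x => x.1) := by
  simpa [toLaurent_X_zero] using Rep.eval (X 0)

theorem coord (p : Option ℂ) : Rep (HahnSeries.C (coord p)) (fun x => coordVal p x.2) := by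
  have h : Rep (HahnSeries.C RatFunc.X) (fun x => x.2) := by
    simpa [toLaurent_X_one, EquivariantPlane.coord] using Rep.eval (X 1)
  cases p with
  | none =>
    simp only [EquivariantPlane.coord, coordVal, map_inv₀]
    exact h.inv (HahnSeries.C_ne_zero RatFunc.X_ne_zero)
  | some b =>
    simpa [EquivariantPlane.coord, coordVal, sub_eq_add_neg, RatFunc.algebraMap_eq_C]
      using h.add (Rep.const (-b))

theorem sum {ι : Type*} (s : Finset ι) {φ : ι → LaurentSeries (RatFunc ℂ)} {f : ι → ℂ × ℂ → ℂ}
    (h : ∀ i, Rep (φ i) (f i)) : Rep (∑ i ∈ s, φ i) (fun x => ∑ i ∈ s, f i x) := by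
  classical
  induction s using Finset.induction_on with
  | empty => simpa using Rep.const 0
  | insert i s hi ih =>
    simp only [Finset.sum_insert hi]
    exact (h i).add ih

/-- Each point may use its own affine coordinate, while all series and all generic functions refer
to the single parameter $z$. -/
theorem toLaurent (p : Option ℂ) (N : MvPolynomial (Fin 2) ℂ) :
    Rep (toLaurent p N) (fun x => MvPolynomial.eval ![x.1, coordVal p x.2] N) := by
  induction N using MvPolynomial.induction_on with
  | C a => simpa [toLaurent_C] using Rep.const a
  | add N N' h h' => simpa using h.add h'
  | mul_X N i h =>
    simp only [map_mul, eval_X]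
    refine h.mul ?_
    fin_cases i
    · simpa [toLaurent_X_zero] using Rep.var
    · simpa [toLaurent_X_one] using Rep.coord p

theorem slice (p : Option ℂ) (c : ℂ) (N : MvPolynomial (Fin 2) ℂ) :
    Rep (HahnSeries.C (aeval ![algebraMap ℂ (RatFunc ℂ) c, EquivariantPlane.coord p] N))
      (fun x => MvPolynomial.eval ![c, coordVal p x.2] N) := by
  induction N using MvPolynomial.induction_on with
  | C a => simpa using Rep.const a
  | add N N' h h' =>
    simp only [map_add]
    exact h.add h'
  | mul_X N i h =>
    simp only [map_mul, eval_X, aeval_X]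
    refine h.mul ?_
    fin_cases i
    · simpa using Rep.const c
    · simpa using Rep.coord p

end Rep

theorem hasVal_slice (p : Option ℂ) (c : ℂ) (N : MvPolynomial (Fin 2) ℂ) :
    HasVal p (aeval ![algebraMap ℂ (RatFunc ℂ) c, coord p] N) (eval ![c, 0] N) := by
  induction N using MvPolynomial.induction_on with
  | C a => simpa using HasVal.const p a
  | add N N' h h' => simpa using h.add h'
  | mul_X N i h =>
    simp only [map_mul, eval_X, aeval_X]
    refine h.mul ?_
    fin_cases i
    · simpa using HasVal.const p c
    · simpa using HasVal.coord p

theorem HasVal.ne_zero {p : Option ℂ} {f : RatFunc ℂ} {a : ℂ} (h : HasVal p f a) (ha : a ≠ 0) :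
    f ≠ 0 := by
  rintro rfl
  exact ha (h.unique (by simpa using HasVal.const p 0))

theorem toPowerSeries_mem (p : Option ℂ) (N : MvPolynomial (Fin 2) ℂ) :
    toPowerSeries p N ∈ powerSeriesSubring (localRing p).toSubring := by
  have hC : ∀ a ∈ localRing p,
      PowerSeries.C a ∈ powerSeriesSubring (localRing p).toSubring := by
    intro a ha n
    rw [PowerSeries.coeff_C]
    split_ifs
    exacts [ha, zero_mem _]
  induction N using MvPolynomial.induction_on with
  | C a =>
    rw [toPowerSeries, aeval_C, PowerSeries.algebraMap_apply]
    exact hC (algebraMap ℂ (RatFunc ℂ) a) (algebraMap_mem _ _)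
  | add N N' h h' =>
    rw [map_add]
    exact add_mem h h'
  | mul_X N i h =>
    rw [map_mul]
    refine mul_mem h ?_
    rw [toPowerSeries, aeval_X]
    fin_cases i
    · intro n
      simp only [Fin.zero_eta, Matrix.cons_val_zero, PowerSeries.coeff_X]
      split_ifs
      exacts [one_mem _, zero_mem _]
    · exact hC _ (HasVal.coord p).mem

theorem constantCoeff_toPowerSeries (p : Option ℂ) (N : MvPolynomial (Fin 2) ℂ) :
    PowerSeries.constantCoeff (toPowerSeries p N)
      = aeval ![algebraMap ℂ (RatFunc ℂ) 0, coord p] N := by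
  induction N using MvPolynomial.induction_on with
  | C a =>
    rw [toPowerSeries, aeval_C, aeval_C]
    exact PowerSeries.constantCoeff_C _
  | add N N' h h' => rw [map_add, map_add, map_add, h, h']
  | mul_X N i h =>
    rw [map_mul, map_mul, map_mul, h, toPowerSeries, aeval_X, aeval_X]
    congr 1
    fin_cases i <;> simp

theorem inv_mem_powerSeriesSubring {K : Type*} [Field K] {O : Subring K} {φ : PowerSeries K}
    (h : φ ∈ powerSeriesSubring O) (h0 : PowerSeries.constantCoeff φ ≠ 0)
    (h1 : (PowerSeries.constantCoeff φ)⁻¹ ∈ O) : φ⁻¹ ∈ powerSeriesSubring O := by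
  obtain ⟨ψ, rfl⟩ := exists_lift_powerSeries h
  have hc : PowerSeries.constantCoeff (PowerSeries.map O.subtype ψ)
      = (PowerSeries.constantCoeff ψ : O) := by
    rw [← PowerSeries.coeff_zero_eq_constantCoeff_apply, PowerSeries.coeff_map,
      PowerSeries.coeff_zero_eq_constantCoeff_apply]
    rfl
  have hu : IsUnit (PowerSeries.constantCoeff ψ) := by
    refine IsUnit.of_mul_eq_one ⟨_, h1⟩ (Subtype.ext ?_)
    change ((PowerSeries.constantCoeff ψ : O) : K) * _ = 1
    rw [← hc]
    exact mul_inv_cancel₀ h0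
  obtain ⟨ψ', hψ'⟩ := (PowerSeries.isUnit_iff_constantCoeff.2 hu).exists_right_inv
  have : (PowerSeries.map O.subtype ψ)⁻¹ = PowerSeries.map O.subtype ψ' := by
    rw [PowerSeries.inv_eq_iff_mul_eq_one h0, mul_comm, ← map_mul, hψ', map_one]
  rw [this]
  exact map_mem_powerSeriesSubring _

theorem inv_toPowerSeries_mem {p : Option ℂ} {G : MvPolynomial (Fin 2) ℂ}
    (hG : eval ![0, 0] G ≠ 0) :
    PowerSeries.constantCoeff (toPowerSeries p G) ≠ 0 ∧
      (toPowerSeries p G)⁻¹ ∈ powerSeriesSubring (localRing p).toSubring := by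
  have h := hasVal_slice p 0 G
  rw [← constantCoeff_toPowerSeries] at h
  exact ⟨h.ne_zero hG, inv_mem_powerSeriesSubring (toPowerSeries_mem p G) (h.ne_zero hG)
    (h.inv hG).mem⟩

theorem toLaurent_ne_zero {p : Option ℂ} {G : MvPolynomial (Fin 2) ℂ}
    (hG : eval ![0, 0] G ≠ 0) : toLaurent p G ≠ 0 := by
  intro h
  rw [toLaurent_apply, ← map_zero (HahnSeries.ofPowerSeries ℤ (RatFunc ℂ))] at h
  refine (inv_toPowerSeries_mem (p := p) hG).1 ?_
  rw [HahnSeries.ofPowerSeries_injective h, map_zero]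

theorem eventually_eval_coordVal_ne_zero {p : Option ℂ} {G : MvPolynomial (Fin 2) ℂ}
    (hG : eval ![0, 0] G ≠ 0) : ∀ᶠ x in generic, eval ![x.1, coordVal p x.2] G ≠ 0 :=
  (Rep.toLaurent p G).eventually_ne_zero (toLaurent_ne_zero hG)

theorem eventually_eval_slice_ne_zero {p : Option ℂ} {c : ℂ} {G : MvPolynomial (Fin 2) ℂ}
    (hG : eval ![c, 0] G ≠ 0) : ∀ᶠ x in generic, eval ![c, coordVal p x.2] G ≠ 0 :=
  (Rep.slice p c G).eventually_ne_zero
    (HahnSeries.C_ne_zero ((hasVal_slice p c G).ne_zero hG))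

/-- The power series that represents a function which is regular at `(0, p)`. -/
theorem exists_rep_powerSeries {p : Option ℂ} {f : ℂ × ℂ → ℂ} {N G : MvPolynomial (Fin 2) ℂ}
    (hG : eval ![0, 0] G ≠ 0) (hf : ∀ᶠ x in generic,
      f x * eval ![x.1, coordVal p x.2] G = eval ![x.1, coordVal p x.2] N) :
    ∃ ψ : PowerSeries (RatFunc ℂ), Rep (HahnSeries.ofPowerSeries ℤ (RatFunc ℂ) ψ) f ∧
      PowerSeries.constantCoeff ψ * aeval ![algebraMap ℂ (RatFunc ℂ) 0, coord p] G
        = aeval ![algebraMap ℂ (RatFunc ℂ) 0, coord p] N := by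
  obtain ⟨h0, -⟩ := inv_toPowerSeries_mem (p := p) hG
  have hmul : toPowerSeries p N * (toPowerSeries p G)⁻¹ * toPowerSeries p G
      = toPowerSeries p N := by
    rw [mul_assoc, PowerSeries.inv_mul_cancel _ h0, mul_one]
  refine ⟨toPowerSeries p N * (toPowerSeries p G)⁻¹, ?_, ?_⟩
  · have h1 := (Rep.toLaurent p N).mul ((Rep.toLaurent p G).inv (toLaurent_ne_zero hG))
    have h2 : HahnSeries.ofPowerSeries ℤ (RatFunc ℂ) (toPowerSeries p N * (toPowerSeries p G)⁻¹)
        = toLaurent p N * (toLaurent p G)⁻¹ := by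
      rw [eq_mul_inv_iff_mul_eq₀ (toLaurent_ne_zero hG), toLaurent_apply, ← map_mul, hmul]
      rfl
    rw [h2]
    refine h1.congr ?_
    filter_upwards [hf, eventually_eval_coordVal_ne_zero hG] with x hx hx0
    rw [← hx, mul_inv_cancel_right₀ hx0]
  · rw [← constantCoeff_toPowerSeries, ← constantCoeff_toPowerSeries, ← map_mul, hmul]

/-- The Laurent series that represents a function which is regular near `(0, p)` outside the line
`x.1 = 0`. -/
theorem exists_rep_laurent {p : Option ℂ} {f : ℂ × ℂ → ℂ} {N H : MvPolynomial (Fin 2) ℂ} {n : ℕ}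
    (hH : eval ![0, 0] H ≠ 0) (hf : ∀ᶠ x in generic,
      f x * (x.1 * eval ![x.1, coordVal p x.2] H) ^ n = eval ![x.1, coordVal p x.2] N) :
    ∃ φ ∈ laurentSubring (localRing p).toSubring, Rep φ f := by
  obtain ⟨h0, hmem⟩ := inv_toPowerSeries_mem (p := p) hH
  have ht : (HahnSeries.single 1 1 : LaurentSeries (RatFunc ℂ)) ≠ 0 := by
    simp
  have hne := mul_ne_zero ht (toLaurent_ne_zero (p := p) hH)
  have hrep := Rep.var.mul (Rep.toLaurent p H)
  have hpow : ∀ n : ℕ, Rep ((HahnSeries.single 1 1 * toLaurent p H) ^ n)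
      (fun x => (x.1 * eval ![x.1, coordVal p x.2] H) ^ n) := by
    intro n
    induction n with
    | zero => simpa using Rep.const 1
    | succ n ih => simpa only [pow_succ] using ih.mul hrep
  refine ⟨toLaurent p N * ((HahnSeries.single 1 1 * toLaurent p H) ^ n)⁻¹, ?_, ?_⟩
  · refine mul_mem (ofPowerSeries_mem_laurentSubring (toPowerSeries_mem p N)) ?_
    -- Inverting the variable only shifts coefficients, and `H`, being nonzero at $(0,p)$, is
    -- invertible as a power series over the local ring.
    rw [← inv_pow, mul_inv]
    refine pow_mem (mul_mem ?_ ?_) n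
    · have : (HahnSeries.single 1 1 : LaurentSeries (RatFunc ℂ))⁻¹ = HahnSeries.single (-1) 1 := by
        rw [HahnSeries.inv_single, inv_one]
      rw [this]
      intro k
      rw [HahnSeries.coeff_single]
      split_ifs
      exacts [one_mem _, zero_mem _]
    · have : (toLaurent p H)⁻¹ = HahnSeries.ofPowerSeries ℤ (RatFunc ℂ) (toPowerSeries p H)⁻¹ := by
        refine (eq_inv_of_mul_eq_one_right ?_).symm
        rw [toLaurent_apply, ← map_mul, PowerSeries.mul_inv_cancel _ h0, map_one]
      rw [this]
      exact ofPowerSeries_mem_laurentSubring hmem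
  · refine ((Rep.toLaurent p N).mul ((hpow n).inv (pow_ne_zero n hne))).congr ?_
    filter_upwards [hf, ((hpow n).eventually_ne_zero (pow_ne_zero n hne))] with x hx hx0
    rw [← hx, mul_inv_cancel_right₀ hx0]

/-- The rational function that represents a function on a line which is regular at `p`. -/
theorem exists_rep_slice {p : Option ℂ} {c : ℂ} {f : ℂ → ℂ} {N G : MvPolynomial (Fin 2) ℂ}
    (hG : eval ![c, 0] G ≠ 0) (hf : ∀ᶠ x in generic,
      f x.2 * eval ![c, coordVal p x.2] G = eval ![c, coordVal p x.2] N) :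
    ∃ g, HasVal p g (eval ![c, 0] N / eval ![c, 0] G) ∧
      g * aeval ![algebraMap ℂ (RatFunc ℂ) c, coord p] G
        = aeval ![algebraMap ℂ (RatFunc ℂ) c, coord p] N ∧
      Rep (HahnSeries.C g) (fun x => f x.2) := by
  have hne := (hasVal_slice p c G).ne_zero hG
  refine ⟨_, (hasVal_slice p c N).mul ((hasVal_slice p c G).inv hG), ?_, ?_⟩
  · rw [inv_mul_cancel_right₀ hne]
  · have := (Rep.slice p c N).mul ((Rep.slice p c G).inv (HahnSeries.C_ne_zero hne))
    rw [map_mul, map_inv₀]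
    refine this.congr ?_
    filter_upwards [hf, eventually_eval_slice_ne_zero hG] with x hx hx0
    rw [← hx, mul_inv_cancel_right₀ hx0]

/-- A function on a principal open subset of affine space that is locally a quotient of polynomials
is globally such a quotient. -/
theorem exists_global_quotient {σ : Type*} [Finite σ] (h : MvPolynomial σ ℂ)
    (f : (σ → ℂ) → ℂ) (hf : ∀ x, eval x h ≠ 0 → ∃ N G : MvPolynomial σ ℂ, eval x G ≠ 0 ∧
      ∀ y, eval y h ≠ 0 → eval y G ≠ 0 → f y * eval y G = eval y N) :
    ∃ (n : ℕ) (N : MvPolynomial σ ℂ), ∀ y, eval y h ≠ 0 → f y * eval y h ^ n = eval y N := by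
  -- The ideal of denominators of `f`. The local quotients show that it has no zero where `h ≠ 0`,
  -- so by the Nullstellensatz it contains a power of `h`.
  let I : Ideal (MvPolynomial σ ℂ) :=
    { carrier := {G | ∃ N, ∀ y, eval y h ≠ 0 → f y * eval y G = eval y N}
      add_mem' := fun ⟨N, hN⟩ ⟨N', hN'⟩ => ⟨N + N', fun y hy => by
        rw [map_add, mul_add, hN y hy, hN' y hy, map_add]⟩
      zero_mem' := ⟨0, fun y _ => by simp⟩
      smul_mem' := fun c G ⟨N, hN⟩ => ⟨c * N, fun y hy => by
        rw [smul_eq_mul, map_mul, mul_left_comm, hN y hy, map_mul]⟩ }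
  have hrad : h ∈ I.radical := by
    rw [← vanishingIdeal_zeroLocus_eq_radical (k := ℂ) (K := ℂ), mem_vanishingIdeal_iff]
    intro x hx
    rw [mem_zeroLocus_iff] at hx
    by_contra h0
    obtain ⟨N, G, hG, hN⟩ := hf x (by simpa [aeval_eq_eval] using h0)
    -- The local formula says nothing where `G` vanishes; a second factor `G` makes both sides 0
    -- there.
    have := hx (G * G) ⟨N * G, fun y hy => by
      by_cases hGy : eval y G = 0
      · simp [hGy]
      · rw [map_mul, ← mul_assoc, hN y hy hGy, map_mul]⟩
    simp [aeval_eq_eval] at this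
    exact hG this
  obtain ⟨n, N, hN⟩ := hrad
  exact ⟨n, N, fun y hy => by rw [← hN y hy, map_pow]⟩

/-! ### Matrices -/

/-- The matrix `Φ` of Laurent series represents the generic matrix function `F`. -/
def RepMatrix {r : ℕ} (Φ : Matrix (Fin r) (Fin r) (LaurentSeries (RatFunc ℂ)))
    (F : ℂ × ℂ → Matrix (Fin r) (Fin r) ℂ) : Prop :=
  ∀ a b, Rep (Φ a b) (fun x => F x a b)

namespace RepMatrix

variable {r : ℕ} {Φ Ψ : Matrix (Fin r) (Fin r) (LaurentSeries (RatFunc ℂ))}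
  {F G : ℂ × ℂ → Matrix (Fin r) (Fin r) ℂ}

theorem congr (h : RepMatrix Φ F) (hFG : ∀ᶠ x in generic, F x = G x) : RepMatrix Φ G :=
  fun a b => (h a b).congr (by filter_upwards [hFG] with x hx; rw [hx])

theorem unique (h : RepMatrix Φ F) (h' : RepMatrix Ψ F) : Φ = Ψ := by
  ext1 a b
  exact (h a b).unique (h' a b)

theorem mul (h : RepMatrix Φ F) (h' : RepMatrix Ψ G) :
    RepMatrix (Φ * Ψ) (fun x => F x * G x) := fun a b =>
  Rep.sum _ fun c => (h a c).mul (h' c b)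

theorem one : RepMatrix (1 : Matrix (Fin r) (Fin r) _) (fun _ => 1) := by
  intro a b
  by_cases hab : a = b
  · subst hab
    simp only [Matrix.one_apply_eq]
    simpa using Rep.const 1
  · simp only [Matrix.one_apply_ne hab]
    simpa using Rep.const 0

end RepMatrix

/-! ### The pencil of lines spanned by the line `W` and the line `λ_x` -/

theorem eval_smul_of_isHomogeneous {σ : Type*} [Fintype σ] {F : MvPolynomial σ ℂ} {d : ℕ}
    (hF : F.IsHomogeneous d) (l : ℂ) (v : σ → ℂ) : eval (l • v) F = l ^ d * eval v F := by
  rw [eval_eq', eval_eq', Finset.mul_sum]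
  refine Finset.sum_congr rfl fun m hm => ?_
  have hdeg : ∑ i, m i = d := by
    have := hF (mem_support_iff.1 hm)
    simpa [Finsupp.weight_apply, Finsupp.sum_fintype] using this
  simp only [Pi.smul_apply, smul_eq_mul, mul_pow, Finset.prod_mul_distrib,
    Finset.prod_pow_eq_pow_sum,
    hdeg]
  ring

/-- The point of the affine plane over the projective line with coordinate `u` around `p`. -/
def paramVec (p : Option ℂ) (u : ℂ) : Fin 2 → ℂ :=
  match p with
  | some b => ![1, b + u]
  | none => ![u, 1]

/-- A parametrization of the line `v₀ + c (x₀ v₁ + x₁ v₂) = 0`, for each `c`. -/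
def pencilVec (x : Fin 2 → ℂ) (c : ℂ) (p : Option ℂ) (u : ℂ) : Fin 3 → ℂ :=
  ![-c * (x 0 * paramVec p u 0 + x 1 * paramVec p u 1), paramVec p u 0, paramVec p u 1]

theorem pencilVec_ne_zero (x : Fin 2 → ℂ) (c : ℂ) (p : Option ℂ) (u : ℂ) :
    pencilVec x c p u ≠ 0 := by
  intro h
  cases p with
  | none => simpa [pencilVec, paramVec] using congrFun h 2
  | some b => simpa [pencilVec, paramVec] using congrFun h 1

/-- The point of the dual plane with homogeneous coordinates `pencilVec x c p u`. -/
def pencilPt (x : Fin 2 → ℂ) (c : ℂ) (p : Option ℂ) (u : ℂ) : DualPlane :=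
  Projectivization.mk ℂ (pencilVec x c p u) (pencilVec_ne_zero x c p u)

/-- The point with affine parameter `z` on the line of the pencil. -/
def linePt (x : Fin 2 → ℂ) (c z : ℂ) : DualPlane := pencilPt x c (some 0) z

theorem pencilPt_some_zero (x : Fin 2 → ℂ) (c z : ℂ) : pencilPt x c (some z) 0 = linePt x c z := by
  simp only [pencilPt, linePt, pencilVec, paramVec, add_zero, zero_add]

theorem pencilPt_coordVal_some (x : Fin 2 → ℂ) (c b z : ℂ) :
    pencilPt x c (some b) (coordVal (some b) z) = linePt x c z := by
  simp only [pencilPt, linePt, pencilVec, paramVec, coordVal, zero_add, add_sub_cancel]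

/-- Around infinity the two vectors differ by the factor $z^{-1}$. The value $z=0$ is excluded
because `coordVal none` takes the default value 0 there. -/
theorem pencilPt_coordVal (x : Fin 2 → ℂ) (c : ℂ) (p : Option ℂ) {z : ℂ} (hz : z ≠ 0) :
    pencilPt x c p (coordVal p z) = linePt x c z := by
  cases p with
  | some b => exact pencilPt_coordVal_some x c b z
  | none =>
    refine (Projectivization.mk_eq_mk_iff' _ _ _ _ _).2 ⟨z⁻¹, ?_⟩
    ext i
    fin_cases i
    · simp [pencilVec, paramVec, coordVal]
      field_simp
    · simp [pencilVec, paramVec, coordVal]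
    · simp [pencilVec, paramVec, coordVal, hz]

theorem eventually_snd_ne_zero : ∀ᶠ y in generic, y.2 ≠ 0 := by
  have := (Rep.coord (some 0)).eventually_ne_zero (HahnSeries.C_ne_zero (coord_ne_zero (some 0)))
  simpa [coordVal] using this

theorem eventually_fst_ne_zero : ∀ᶠ y in generic, y.1 ≠ 0 :=
  Rep.var.eventually_ne_zero (by simp)

/-- The parameter of a point on the projective line. -/
def paramOf (q : DualPlane) : Option ℂ :=
  if q.rep 1 = 0 then none else some (q.rep 2 / q.rep 1)

theorem pencilPt_paramOf {x : Fin 2 → ℂ} {c : ℂ} {q : DualPlane}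
    (h : q.rep 0 + c * (x 0 * q.rep 1 + x 1 * q.rep 2) = 0) :
    pencilPt x c (paramOf q) 0 = q := by
  conv_rhs => rw [← q.mk_rep]
  have h0 : q.rep 0 = -c * (x 0 * q.rep 1 + x 1 * q.rep 2) := by linear_combination h
  by_cases h1 : q.rep 1 = 0
  · have h2 : q.rep 2 ≠ 0 := by
      intro h2
      refine q.rep_nonzero ?_
      ext i
      fin_cases i
      · simp [h0, h1, h2]
      · exact h1
      · exact h2
    refine (Projectivization.mk_eq_mk_iff' _ _ _ _ _).2 ⟨(q.rep 2)⁻¹, ?_⟩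
    ext i
    fin_cases i
    · simp [pencilVec, paramVec, paramOf, h1, h0]
      field_simp
    · simp [pencilVec, paramVec, paramOf, h1]
    · simp [pencilVec, paramVec, paramOf, h1, h2]
  · refine (Projectivization.mk_eq_mk_iff' _ _ _ _ _).2 ⟨(q.rep 1)⁻¹, ?_⟩
    ext i
    fin_cases i
    · simp [pencilVec, paramVec, paramOf, h1, h0]
      field_simp
    · simp [pencilVec, paramVec, paramOf, h1]
    · simp [pencilVec, paramVec, paramOf, h1]
      field_simp

theorem mem_lineW_iff {q : DualPlane} : q ∈ lineW ↔ q.rep 0 = 0 := Iff.rfl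

theorem exists_rep_eq_smul (v : Fin 3 → ℂ) (hv : v ≠ 0) :
    ∃ l : ℂ, l ≠ 0 ∧ (Projectivization.mk ℂ v hv).rep = l • v := by
  obtain ⟨a, ha⟩ := Projectivization.exists_smul_eq_mk_rep ℂ v hv
  exact ⟨a, a.ne_zero, ha.symm⟩

theorem mk_mem_lineW_iff {v : Fin 3 → ℂ} {hv : v ≠ 0} :
    Projectivization.mk ℂ v hv ∈ lineW ↔ v 0 = 0 := by
  obtain ⟨l, hl, h⟩ := exists_rep_eq_smul v hv
  rw [mem_lineW_iff, h]
  simp [hl]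

theorem mk_mem_dualLine_iff {x : Fin 2 → ℂ} {v : Fin 3 → ℂ} {hv : v ≠ 0} :
    Projectivization.mk ℂ v hv ∈ dualLine (affinePoint x) ↔ v 0 + (x 0 * v 1 + x 1 * v 2) = 0 := by
  rw [dualLine, Set.mem_ofPred_eq, affinePoint, Projectivization.orthogonal_mk]
  simp [dotProduct, Fin.sum_univ_three, add_assoc]

theorem mem_dualLine_iff {x : Fin 2 → ℂ} {q : DualPlane} :
    q ∈ dualLine (affinePoint x) ↔ q.rep 0 + (x 0 * q.rep 1 + x 1 * q.rep 2) = 0 := by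
  conv_lhs => rw [← q.mk_rep]
  exact mk_mem_dualLine_iff

theorem dualLine_affinePoint_zero : dualLine (affinePoint 0) = lineW := by
  ext q
  rw [mem_dualLine_iff, mem_lineW_iff]
  simp

theorem pencilPt_mem_lineW (x : Fin 2 → ℂ) (p : Option ℂ) (u : ℂ) : pencilPt x 0 p u ∈ lineW := by
  rw [pencilPt, mk_mem_lineW_iff]
  simp [pencilVec]

theorem pencilPt_mem_dualLine (x : Fin 2 → ℂ) (p : Option ℂ) (u : ℂ) :
    pencilPt x 1 p u ∈ dualLine (affinePoint x) := by
  rw [pencilPt, mk_mem_dualLine_iff]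
  simp [pencilVec]

theorem pencilPt_paramOf_of_mem_dualLine {x : Fin 2 → ℂ} {q : DualPlane}
    (h : q ∈ dualLine (affinePoint x)) : pencilPt x 1 (paramOf q) 0 = q :=
  pencilPt_paramOf (by simpa using mem_dualLine_iff.1 h)

/-- Two lines of the pencil meet. -/
theorem exists_pencilPt_eq (x : Fin 2 → ℂ) : ∃ p, ∀ c, pencilPt x c p 0 = pencilPt x 0 p 0 := by
  by_cases h : x 1 = 0
  · exact ⟨none, fun c => by simp [pencilPt, pencilVec, paramVec, h]⟩
  · refine ⟨some (-x 0 / x 1), fun c => ?_⟩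
    have : x 0 + x 1 * (-x 0 / x 1) = 0 := by
      field_simp
      ring
    simp [pencilPt, pencilVec, paramVec, this]

/-- The diagonal torus element with entries `c`. -/
def torusPt (c : ℂ) : Torus := fun _ => if h : c = 0 then 1 else Units.mk0 c h

theorem torusPt_apply {c : ℂ} (hc : c ≠ 0) (k : Fin 2) : (torusPt c k : ℂ) = c := by
  simp [torusPt, hc]

/-- Dividing $v_1,v_2$ by $c$ is projectively the same as multiplying $v_0$ by $c$. One diagonal
one-parameter subgroup thus sweeps out the pencil, except for $W$. -/
theorem torusPt_smul (x : Fin 2 → ℂ) {c : ℂ} (hc : c ≠ 0) (p : Option ℂ) (u : ℂ) :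
    torusPt c • pencilPt x 1 p u = pencilPt x c p u := by
  change planeDiag⁻¹ (torusPt c) • Projectivization.mk ℂ (pencilVec x 1 p u) _ = _
  rw [Projectivization.smul_mk]
  refine (Projectivization.mk_eq_mk_iff' _ _ _ _ _).2 ⟨c⁻¹, ?_⟩
  ext i
  rw [Pi.smul_apply', MonoidHom.inv_apply, Pi.inv_apply, Units.smul_def]
  fin_cases i
  · simp [pencilVec, planeDiag]
    field_simp
    ring
  · simp [pencilVec, planeDiag, torusPt_apply hc]
  · simp [pencilVec, planeDiag, torusPt_apply hc]

/-! ### Pulling back regular functions to the pencil -/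

/-- The polynomials that parametrize the pencil. -/
def pencilPoly (x : Fin 2 → ℂ) (p : Option ℂ) : Fin 3 → MvPolynomial (Fin 2) ℂ :=
  let s : Fin 2 → MvPolynomial (Fin 2) ℂ := match p with
    | some b => ![1, C b + X 1]
    | none => ![X 1, 1]
  ![-X 0 * (C (x 0) * s 0 + C (x 1) * s 1), s 0, s 1]

theorem eval_pencilPoly (x : Fin 2 → ℂ) (p : Option ℂ) (c u : ℂ) (k : Fin 3) :
    eval ![c, u] (pencilPoly x p k) = pencilVec x c p u k := by
  cases p <;> fin_cases k <;> simp [pencilPoly, pencilVec, paramVec]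

theorem eval_bind {σ τ : Type*} (x : τ → ℂ) (g : σ → MvPolynomial τ ℂ) (F : MvPolynomial σ ℂ) :
    eval x (bind₁ g F) = eval (fun k => eval x (g k)) F :=
  eval₂Hom_bind₁ _ _ _ _

theorem eval_bind_pencilPoly (x : Fin 2 → ℂ) (p : Option ℂ) (c u : ℂ)
    (F : MvPolynomial (Fin 3) ℂ) :
    eval ![c, u] (bind₁ (pencilPoly x p) F) = eval (pencilVec x c p u) F := by
  rw [eval_bind]
  congr 2
  ext k
  exact eval_pencilPoly x p c u k

/-- The parametrization is substituted in numerator and denominator. Their degrees are equal, so the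
scalar between `pencilVec` and the chosen representative cancels. -/
theorem exists_quotient_of_isRegularAt {Z : Set DualPlane} {f : DualPlane → ℂ} {x : Fin 2 → ℂ}
    {c : ℂ} {p : Option ℂ} {u : ℂ} (h : IsRegularAt (fun q : Z => f q) (pencilPt x c p u)) :
    ∃ N G : MvPolynomial (Fin 2) ℂ, eval ![c, u] G ≠ 0 ∧ ∀ c' u', pencilPt x c' p u' ∈ Z →
      eval ![c', u'] G ≠ 0 → f (pencilPt x c' p u') * eval ![c', u'] G = eval ![c', u'] N := by
  obtain ⟨d, F, G, hF, hG, h0, hFG⟩ := h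
  refine ⟨bind₁ (pencilPoly x p) F, bind₁ (pencilPoly x p) G, ?_, fun c' u' hZ hne => ?_⟩
  · obtain ⟨l, hl, hrep⟩ := exists_rep_eq_smul _ (pencilVec_ne_zero x c p u)
    rw [pencilPt, hrep, eval_smul_of_isHomogeneous hG] at h0
    rw [eval_bind_pencilPoly]
    exact right_ne_zero_of_mul h0
  · obtain ⟨l, hl, hrep⟩ := exists_rep_eq_smul _ (pencilVec_ne_zero x c' p u')
    rw [eval_bind_pencilPoly] at hne
    have := hFG ⟨_, hZ⟩
    simp only [pencilPt, hrep, eval_smul_of_isHomogeneous hG, eval_smul_of_isHomogeneous hF] at this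
    rw [eval_bind_pencilPoly, eval_bind_pencilPoly, pencilPt,
      this (mul_ne_zero (pow_ne_zero _ hl) hne),
      mul_div_mul_left _ _ (pow_ne_zero _ hl), div_mul_cancel₀ _ hne]

theorem exists_eval_ne_zero_of_isZariskiOpen {D : Set DualPlane} (hD : IsZariskiOpen D)
    {x : Fin 2 → ℂ} {c : ℂ} {p : Option ℂ} {u : ℂ} (h : pencilPt x c p u ∈ D) :
    ∃ G : MvPolynomial (Fin 2) ℂ, eval ![c, u] G ≠ 0 ∧ ∀ c' u', eval ![c', u'] G ≠ 0 →
      pencilPt x c' p u' ∈ D := by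
  obtain ⟨d, G, hG, h0, hGD⟩ := hD _ h
  refine ⟨bind₁ (pencilPoly x p) G, ?_, fun c' u' hne => hGD _ ?_⟩
  · obtain ⟨l, hl, hrep⟩ := exists_rep_eq_smul _ (pencilVec_ne_zero x c p u)
    rw [pencilPt, hrep, eval_smul_of_isHomogeneous hG] at h0
    rw [eval_bind_pencilPoly]
    exact right_ne_zero_of_mul h0
  · obtain ⟨l, hl, hrep⟩ := exists_rep_eq_smul _ (pencilVec_ne_zero x c' p u')
    rw [eval_bind_pencilPoly] at hne
    rw [pencilPt, hrep, eval_smul_of_isHomogeneous hG]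
    exact mul_ne_zero (pow_ne_zero _ hl) hne

theorem eventually_linePt_mem_slice {D : Set DualPlane} (hD : IsZariskiOpen D)
    {x : Fin 2 → ℂ} {c : ℂ} {p : Option ℂ} (h : pencilPt x c p 0 ∈ D) :
    ∀ᶠ y in generic, linePt x c y.2 ∈ D := by
  obtain ⟨G, hG, hGD⟩ := exists_eval_ne_zero_of_isZariskiOpen hD h
  filter_upwards [eventually_eval_slice_ne_zero (p := p) hG, eventually_snd_ne_zero] with y hy hy'
  rw [← pencilPt_coordVal x c p hy']
  exact hGD _ _ hy

theorem eventually_linePt_mem {D : Set DualPlane} (hD : IsZariskiOpen D)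
    {x : Fin 2 → ℂ} {p : Option ℂ} (h : pencilPt x 0 p 0 ∈ D) :
    ∀ᶠ y in generic, linePt x y.1 y.2 ∈ D := by
  obtain ⟨G, hG, hGD⟩ := exists_eval_ne_zero_of_isZariskiOpen hD h
  filter_upwards [eventually_eval_coordVal_ne_zero (p := p) hG, eventually_snd_ne_zero]
    with y hy hy'
  rw [← pencilPt_coordVal x _ p hy']
  exact hGD _ _ hy

/-- Restricted to the line, the equation of the complement is a nonzero polynomial in one variable.
This is the finiteness needed to prescribe principal parts. -/
theorem finite_pencilPt_notMem {D : Set DualPlane} (hD : IsZariskiOpen D)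
    {x : Fin 2 → ℂ} {c : ℂ} {p : Option ℂ} (h : pencilPt x c p 0 ∈ D) :
    {q : Option ℂ | pencilPt x c q 0 ∉ D}.Finite := by
  obtain ⟨G, hG, hGD⟩ := exists_eval_ne_zero_of_isZariskiOpen hD h
  let g : Polynomial ℂ := aeval ![Polynomial.C c, Polynomial.X] G
  have hg : ∀ u, g.eval u = eval ![c, u] G := by
    intro u
    have h1 : Polynomial.aeval u g = aeval ![c, u] G := by
      simp only [g]
      rw [← AlgHom.comp_apply]
      congr 1
      ext k
      fin_cases k <;> simp
    rw [Polynomial.coe_aeval_eq_eval, aeval_eq_eval] at h1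
    exact h1
  have hg0 : g ≠ 0 := by
    rintro h
    have := hg 0
    rw [h, Polynomial.eval_zero] at this
    exact hG this.symm
  have hinj : Function.Injective (coordVal p) := by
    cases p with
    | none => exact inv_injective
    | some b => exact sub_left_injective
  have hfin : {z : ℂ | g.eval (coordVal p z) = 0}.Finite := by
    refine Set.Finite.preimage hinj.injOn (s := {u | g.eval u = 0}) ?_
    exact (Polynomial.finite_setOfPred_isRoot hg0)
  -- `none` and `some 0` are added because the coordinates are compared only where $z\neq0$ and
  -- finite.
  refine ((hfin.image some).union ({none, some 0} : Set (Option ℂ)).toFinite).subset ?_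
  intro q hq
  cases q with
  | none => exact Or.inr (by simp)
  | some z =>
    by_cases hz : z = 0
    · exact Or.inr (by simp [hz])
    · refine Or.inl ⟨z, ?_, rfl⟩
      by_contra hne
      rw [Set.mem_ofPred_eq, hg] at hne
      refine hq ?_
      rw [pencilPt_some_zero, ← pencilPt_coordVal x c p hz]
      exact hGD _ _ hne

/-- The germ at `p` of a regular function on a line of the pencil. -/
theorem exists_hasVal_of_isRegularAt {Z : Set DualPlane} {f : DualPlane → ℂ} {x : Fin 2 → ℂ}
    {c : ℂ} {p : Option ℂ} (h : IsRegularAt (fun q : Z => f q) (pencilPt x c p 0))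
    (hp : pencilPt x c p 0 ∈ Z) (hZ : ∀ᶠ y in generic, linePt x c y.2 ∈ Z) :
    ∃ g, HasVal p g (f (pencilPt x c p 0)) ∧
      Rep (HahnSeries.C g) (fun y => f (linePt x c y.2)) := by
  obtain ⟨N, G, hG, hNG⟩ := exists_quotient_of_isRegularAt h
  obtain ⟨g, hg, -, hrep⟩ := exists_rep_slice (f := fun z => f (linePt x c z)) (p := p)
    (N := N) hG (by
    filter_upwards [hZ, eventually_eval_slice_ne_zero (p := p) hG, eventually_snd_ne_zero]
      with y hy hy' hy''
    rw [← pencilPt_coordVal x c p hy''] at hy ⊢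
    exact hNG _ _ hy hy')
  refine ⟨g, ?_, hrep⟩
  rwa [← hNG _ _ hp hG, mul_div_cancel_right₀ _ hG] at hg

/-- The power series of a regular function along the line `W`. -/
theorem exists_powerSeries_of_isRegularAt {Z : Set DualPlane} {f : DualPlane → ℂ} {x : Fin 2 → ℂ}
    {p : Option ℂ} (h : IsRegularAt (fun q : Z => f q) (pencilPt x 0 p 0))
    (hZ : ∀ᶠ y in generic, linePt x y.1 y.2 ∈ Z) (hZ0 : ∀ᶠ y in generic, linePt x 0 y.2 ∈ Z) :
    ∃ ψ : PowerSeries (RatFunc ℂ),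
      Rep (HahnSeries.ofPowerSeries ℤ (RatFunc ℂ) ψ) (fun y => f (linePt x y.1 y.2)) ∧
      Rep (HahnSeries.C (PowerSeries.constantCoeff ψ)) (fun y => f (linePt x 0 y.2)) := by
  obtain ⟨N, G, hG, hNG⟩ := exists_quotient_of_isRegularAt h
  obtain ⟨ψ, hψ, hψ0⟩ := exists_rep_powerSeries (f := fun y => f (linePt x y.1 y.2)) (p := p)
    (N := N) hG (by
    filter_upwards [hZ, eventually_eval_coordVal_ne_zero (p := p) hG, eventually_snd_ne_zero]
      with y hy hy' hy''
    rw [← pencilPt_coordVal x _ p hy''] at hy ⊢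
    exact hNG _ _ hy hy')
  obtain ⟨g, -, hg, hrep⟩ := exists_rep_slice (f := fun z => f (linePt x 0 z)) (p := p)
    (N := N) hG (by
    filter_upwards [hZ0, eventually_eval_slice_ne_zero (p := p) hG, eventually_snd_ne_zero]
      with y hy hy' hy''
    rw [← pencilPt_coordVal x 0 p hy''] at hy ⊢
    exact hNG _ _ hy hy')
  refine ⟨ψ, hψ, ?_⟩
  rwa [mul_right_cancel₀ ((hasVal_slice p 0 G).ne_zero hG) (hψ0.trans hg.symm)]

/-- A rational function that is regular on a subset of a line defines a regular function. -/
theorem isRegular_of_hasVal {Z : Set DualPlane} {f : Z → ℂ} {g : RatFunc ℂ}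
    (h : ∀ q : Z, HasVal (paramOf q) g (f q)) (h12 : ∀ q ∈ Z, q.rep 1 = 0 → q.rep 2 ≠ 0) :
    IsRegular f := by
  -- The coordinate at `p` as a quotient of linear forms in $v_1,v_2$; `h12` keeps these forms from
  -- vanishing together on `Z`.
  have key : ∀ p : Option ℂ, ∃ num den : MvPolynomial (Fin 3) ℂ, num.IsHomogeneous 1 ∧
      den.IsHomogeneous 1 ∧ (∀ q ∈ Z, paramOf q = p → eval q.rep den ≠ 0 ∧ eval q.rep num = 0) ∧
      ∀ q ∈ Z, eval q.rep den ≠ 0 →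
        HasVal (paramOf q) (coord p) (eval q.rep num / eval q.rep den) := by
    intro p
    cases p with
    | none =>
      refine ⟨X 1, X 2, isHomogeneous_X _ _, isHomogeneous_X _ _, ?_, ?_⟩
      · intro q hq hp
        by_cases h1 : q.rep 1 = 0
        · simpa [h1] using h12 q hq h1
        · simp [paramOf, h1] at hp
      · intro q hq h2
        simp only [eval_X] at h2 ⊢
        by_cases h1 : q.rep 1 = 0
        · simpa [paramOf, h1] using HasVal.coord none
        · simp only [paramOf, h1, if_false]
          have h3 := ((HasVal.coord (some (q.rep 2 / q.rep 1))).add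
            (HasVal.const _ (q.rep 2 / q.rep 1))).inv (by simp [h1, h2])
          simpa [coord, RatFunc.algebraMap_eq_C] using h3
    | some b =>
      refine ⟨X 2 - C b * X 1, X 1, (isHomogeneous_X _ _).sub ?_, isHomogeneous_X _ _, ?_, ?_⟩
      · simpa using (isHomogeneous_C (Fin 3) b).mul (isHomogeneous_X ℂ (1 : Fin 3))
      · intro q hq hp
        by_cases h1 : q.rep 1 = 0
        · simp [paramOf, h1] at hp
        · simp only [paramOf, h1, if_false, Option.some.injEq] at hp
          refine ⟨by simpa using h1, ?_⟩
          simp only [← hp, map_sub, map_mul, eval_X, eval_C]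
          field_simp
          ring
      · intro q hq h1
        simp only [eval_X, map_sub, map_mul, eval_C] at h1 ⊢
        simp only [paramOf, h1, if_false]
        have h3 := (HasVal.coord (some (q.rep 2 / q.rep 1))).add
          (HasVal.const _ (q.rep 2 / q.rep 1 - b))
        have h4 : (q.rep 2 - b * q.rep 1) / q.rep 1 = 0 + (q.rep 2 / q.rep 1 - b) := by
          field_simp
          ring
        rw [h4]
        simpa [coord, RatFunc.algebraMap_eq_C] using h3
  have hpoly : ∀ {p p' : Option ℂ} {u : ℂ} (F : Polynomial ℂ), HasVal p' (coord p) u →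
      HasVal p' (Polynomial.aeval (coord p) F) (F.eval u) := by
    intro p p' u F hu
    induction F using Polynomial.induction_on' with
    | add F F' h h' => simpa using h.add h'
    | monomial n a =>
      have : ∀ n : ℕ, HasVal p' (coord p ^ n) (u ^ n) := by
        intro n
        induction n with
        | zero => simpa using HasVal.const p' 1
        | succ n ih => simpa only [pow_succ] using ih.mul hu
      simpa [Polynomial.aeval_monomial] using (HasVal.const p' a).mul (this n)
  intro q₀
  obtain ⟨F, G, hG0, hFG, -⟩ := h q₀
  obtain ⟨num, den, hnum, hden, hval₀, hval⟩ := key (paramOf q₀)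
  set d := max F.natDegree G.natDegree
  -- The extra factor `den` ensures that a nonzero denominator entails `den ≠ 0`, so that the
  -- coordinate has a finite value.
  have hhom : ∀ P : Polynomial ℂ,
      (aeval ![num, den] (P.homogenize d) * den).IsHomogeneous (d + 1) := by
    intro P
    have := (Polynomial.isHomogeneous_homogenize (n := d) P).aeval (g := ![num, den]) (n := 1) (by
      intro i
      fin_cases i
      exacts [hnum, hden])
    rw [one_mul] at this
    exact this.mul hden
  have heval : ∀ (P : Polynomial ℂ), P.natDegree ≤ d → ∀ q : DualPlane, eval q.rep den ≠ 0 →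
      eval q.rep (aeval ![num, den] (P.homogenize d) * den)
        = P.eval (eval q.rep num / eval q.rep den) * (eval q.rep den ^ d * eval q.rep den) := by
    intro P hP q hq
    have h1 : eval q.rep (aeval ![num, den] (P.homogenize d))
        = eval ![eval q.rep num, eval q.rep den] (P.homogenize d) := by
      refine (eval_bind _ _ _).trans ?_
      congr 2
      ext i
      fin_cases i <;> rfl
    rw [map_mul, h1, Polynomial.eval_homogenize hP _ (by simpa using hq), mul_assoc]
    rfl
  obtain ⟨hd0, hn0⟩ := hval₀ q₀ q₀.2 rfl
  refine ⟨d + 1, _, _, hhom F, hhom G, ?_, fun q hq => ?_⟩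
  · rw [heval G (le_max_right _ _) _ hd0, hn0, zero_div]
    exact mul_ne_zero hG0 (mul_ne_zero (pow_ne_zero _ hd0) hd0)
  · have hd : eval q.1.rep den ≠ 0 := by
      intro h0
      rw [map_mul, h0, mul_zero] at hq
      exact hq rfl
    rw [heval G (le_max_right _ _) _ hd] at hq ⊢
    rw [heval F (le_max_left _ _) _ hd, mul_div_mul_right _ _ (right_ne_zero_of_mul hq),
      eq_div_iff (left_ne_zero_of_mul hq)]
    have h1 := hval q q.2 hd
    have h2 := (h q).mul (hpoly G h1)
    rw [hFG] at h2
    exact h2.unique (hpoly F h1)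

/-- A regular function on a line `λ_x` is constant. -/
theorem isRegular_dualLine_const {x : Fin 2 → ℂ} {f : DualPlane → ℂ}
    (hf : IsRegular (fun q : dualLine (affinePoint x) => f q)) :
    ∃ a, ∀ q ∈ dualLine (affinePoint x), f q = a := by
  choose g hg hrep using fun p => exists_hasVal_of_isRegularAt (c := 1) (p := p)
    (hf ⟨_, pencilPt_mem_dualLine x p 0⟩) (pencilPt_mem_dualLine x p 0)
    (Filter.Eventually.of_forall fun y => pencilPt_mem_dualLine x (some 0) y.2)
  -- All germs represent the same generic function, so there is one rational function, regular at
  -- every point.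
  have heq : ∀ p, g p = g none := fun p => HahnSeries.C_injective ((hrep p).unique (hrep none))
  obtain ⟨a, ha⟩ := exists_eq_const_of_forall_mem (f := g none) fun p => by
    rw [← heq p]
    exact (hg p).mem
  refine ⟨a, fun q hq => ?_⟩
  have h1 := hg (paramOf q)
  rw [heq, ha, pencilPt_paramOf_of_mem_dualLine hq] at h1
  exact h1.unique (HasVal.const _ a)

/-! ### Regularity of inverse matrices -/

theorem IsRegularAt.const {Z : Set DualPlane} {p : DualPlane} (a : ℂ) :
    IsRegularAt (fun _ : Z => a) p :=
  ⟨0, MvPolynomial.C a, 1, MvPolynomial.isHomogeneous_C _ _, MvPolynomial.isHomogeneous_one _ _,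
    by simp, by simp⟩

/-- The functions on `Z` that are regular at `p`. -/
def regularSubring (Z : Set DualPlane) (p : DualPlane) : Subring (Z → ℂ) where
  carrier := {f | IsRegularAt f p}
  mul_mem' := IsRegularAt.mul
  one_mem' := .const 1
  add_mem' := IsRegularAt.add
  zero_mem' := .zero
  neg_mem' {f} hf := by
    have := (IsRegularAt.const (Z := Z) (p := p) (-1)).mul hf
    simpa [Pi.neg_def] using this

theorem IsRegularAt.inv {Z : Set DualPlane} {p : DualPlane} (hp : p ∈ Z) {f : Z → ℂ}
    (hf : IsRegularAt f p) (h0 : f ⟨p, hp⟩ ≠ 0) : IsRegularAt (fun q => (f q)⁻¹) p := by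
  obtain ⟨d, F, G, hF, hG, hG0, h⟩ := hf
  have hF0 : MvPolynomial.eval p.rep F ≠ 0 := by
    intro h1
    rw [h ⟨p, hp⟩ hG0, h1, zero_div] at h0
    exact h0 rfl
  refine ⟨d + d, G * G, G * F, hG.mul hG, hG.mul hF, by simp [hG0, hF0], fun q hq => ?_⟩
  simp only [map_mul, ne_eq, mul_eq_zero, not_or] at hq ⊢
  rw [h q hq.1, inv_div, mul_div_mul_left _ _ hq.1]

/-- Cramer's rule: determinant and adjugate are formed in the ring of functions regular at `p`, and
the determinant is nonzero at `p`. -/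
theorem IsRegularAt.matrix_inv {Z : Set DualPlane} {p : DualPlane} (hp : p ∈ Z) {r : ℕ}
    {M : Z → Matrix (Fin r) (Fin r) ℂ} (hM : ∀ a b, IsRegularAt (fun q => M q a b) p)
    (hu : IsUnit (M ⟨p, hp⟩)) (a b : Fin r) : IsRegularAt (fun q => (M q)⁻¹ a b) p := by
  let N : Matrix (Fin r) (Fin r) (regularSubring Z p) := Matrix.of fun a b => ⟨_, hM a b⟩
  have hN : ∀ q : Z,
      ((Pi.evalRingHom (fun _ : Z => ℂ) q).comp (regularSubring Z p).subtype).mapMatrix N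
      = M q := fun q => rfl
  have hdet : IsRegularAt (fun q => (M q).det) p := by
    have : (fun q => (M q).det) = (N.det : Z → ℂ) := by
      ext q
      rw [← hN q, ← RingHom.map_det]
      rfl
    rw [this]
    exact N.det.2
  have hadj : IsRegularAt (fun q => (M q).adjugate a b) p := by
    have : (fun q => (M q).adjugate a b) = (N.adjugate a b : Z → ℂ) := by
      ext q
      rw [← hN q, ← RingHom.map_adjugate]
      rfl
    rw [this]
    exact (N.adjugate a b).2
  have := (hdet.inv hp ((Matrix.isUnit_iff_isUnit_det _).1 hu).ne_zero).mul hadj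
  simpa only [Matrix.inv_def, Ring.inverse_eq_inv', Matrix.smul_apply, smul_eq_mul] using this

theorem IsRegularAt.matrix_mul {Z : Set DualPlane} {p : DualPlane} {l m n : ℕ}
    {M : Z → Matrix (Fin l) (Fin m) ℂ} {N : Z → Matrix (Fin m) (Fin n) ℂ}
    (hM : ∀ a b, IsRegularAt (fun q => M q a b) p) (hN : ∀ a b, IsRegularAt (fun q => N q a b) p)
    (a : Fin l) (b : Fin n) : IsRegularAt (fun q => (M q * N q) a b) p :=
  IsRegularAt.sum fun c => (hM a c).mul (hN c b)

theorem IsZariskiOpen.inter {U V : Set DualPlane} (hU : IsZariskiOpen U) (hV : IsZariskiOpen V) :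
    IsZariskiOpen (U ∩ V) := by
  intro p hp
  obtain ⟨d, G, hG, hG0, h⟩ := hU p hp.1
  obtain ⟨d', G', hG', hG0', h'⟩ := hV p hp.2
  refine ⟨d + d', G * G', hG.mul hG', by simp [hG0, hG0'], fun q hq => ?_⟩
  rw [map_mul] at hq
  exact ⟨h q (left_ne_zero_of_mul hq), h' q (right_ne_zero_of_mul hq)⟩

/-! ### Morphisms have constant rank -/

theorem isUnit_toMatrix_of_linearEquiv {r : ℕ} (e : (Fin r → ℂ) ≃ₗ[ℂ] (Fin r → ℂ)) :
    IsUnit (LinearMap.toMatrix' e.toLinearMap) := by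
  refine IsUnit.of_mul_eq_one (LinearMap.toMatrix' e.symm.toLinearMap) ?_
  rw [← LinearMap.toMatrix'_comp]
  simp

/-- In global frames `e`, `e'` the matrix of `f` has regular entries on a projective line, so it is
constant. -/
theorem exists_finrank_range_eq_on_dualLine {E E' : VBundle} {f : ∀ p, E.fiber p →ₗ[ℂ] E'.fiber p}
    (hf : E.IsRegularMap E' f) {x : Fin 2 → ℂ} (hE : E.TrivialOn (dualLine (affinePoint x)))
    (hE' : E'.TrivialOn (dualLine (affinePoint x))) :
    ∃ r : ℕ, ∀ q ∈ dualLine (affinePoint x), Module.finrank ℂ (LinearMap.range (f q)) = r := by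
  classical
  obtain ⟨e, he⟩ := hE
  obtain ⟨e', he'⟩ := hE'
  let m : dualLine (affinePoint x) → Matrix (Fin E'.rank) (Fin E.rank) ℂ := fun q =>
    LinearMap.toMatrix' ((e' q).symm.toLinearMap ∘ₗ f q ∘ₗ (e q).toLinearMap)
  have hreg : ∀ a b, IsRegular fun q => m q a b := by
    rintro a b ⟨p, hp⟩
    obtain ⟨i, hi⟩ := E.cover p
    obtain ⟨j, hj⟩ := E'.cover p
    let Z : Set DualPlane := dualLine (affinePoint x) ∩ E.dom i ∩ E'.dom j
    let M : Z → Matrix (Fin E.rank) (Fin E.rank) ℂ := fun q => LinearMap.toMatrix'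
      ((E.triv i ⟨q, q.2.1.2⟩).toLinearMap ∘ₗ (e ⟨q, q.2.1.1⟩).toLinearMap)
    let M' : Z → Matrix (Fin E'.rank) (Fin E'.rank) ℂ := fun q => LinearMap.toMatrix'
      ((e' ⟨q, q.2.1.1⟩).trans (E'.triv j ⟨q, q.2.2⟩)).toLinearMap
    let F : Z → Matrix (Fin E'.rank) (Fin E.rank) ℂ := fun q => LinearMap.toMatrix'
      ((E'.triv j ⟨q, q.2.2⟩).toLinearMap ∘ₗ f q ∘ₗ (E.triv i ⟨q, q.2.1.2⟩).symm.toLinearMap)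
    have hM : ∀ a b, IsRegularAt (fun q => M q a b) p := fun a b =>
      IsRegularAt.of_local (E'.isOpen_dom j) hj (he i b a ⟨p, hp, hi⟩)
        (fun q hq _ => ⟨hq.1, by simp [M, LinearMap.toMatrix'_apply]⟩)
    have hM' : ∀ a b, IsRegularAt (fun q => M' q a b) p := fun a b =>
      IsRegularAt.of_local (E'.isOpen_dom j) hj (he' j b a ⟨p, hp, hj⟩)
        (fun q hq _ => ⟨⟨hq.1.1, hq.2⟩, by simp [M', LinearMap.toMatrix'_apply]⟩)
    have hF : ∀ a b, IsRegularAt (fun q => F q a b) p := fun a b =>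
      IsRegularAt.of_local (E'.isOpen_dom j) hj (hf i j b a ⟨p, hi, hj⟩)
        (fun q hq _ => ⟨⟨hq.1.2, hq.2⟩, by simp [F, LinearMap.toMatrix'_apply]⟩)
    have hpZ : p ∈ Z := ⟨⟨hp, hi⟩, hj⟩
    have hu : ∀ q, IsUnit (M' q) := fun q => isUnit_toMatrix_of_linearEquiv _
    have hall := IsRegularAt.matrix_mul (IsRegularAt.matrix_inv hpZ hM' (hu _))
      (IsRegularAt.matrix_mul hF hM) a b
    -- Regularity is read off near `p` from $m=M'^{-1}FM$, with `M`, `M'` the frames and `F` the map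
    -- in local charts.
    refine IsRegularAt.of_local ((E.isOpen_dom i).inter (E'.isOpen_dom j)) ⟨hi, hj⟩ hall ?_
    intro q hq hqU
    refine ⟨⟨⟨hq, hqU.1⟩, hqU.2⟩, ?_⟩
    let q' : Z := ⟨q, ⟨hq, hqU.1⟩, hqU.2⟩
    have h1 : M' q' * m ⟨q, hq⟩ = F q' * M q' := by
      simp only [M', F, M, m, ← LinearMap.toMatrix'_comp]
      congr 1
      refine LinearMap.ext fun v => ?_
      simp [q']
    have h2 : m ⟨q, hq⟩ = (M' q')⁻¹ * (F q' * M q') := by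
      rw [← h1, ← Matrix.mul_assoc, Matrix.nonsing_inv_mul _
        ((Matrix.isUnit_iff_isUnit_det _).1 (hu q')),
        Matrix.one_mul]
    exact congrFun (congrFun h2 a) b
  have hconst : ∀ a b, ∃ z, ∀ q, m q a b = z := by
    intro a b
    let f' : DualPlane → ℂ := fun q =>
      if h : q ∈ dualLine (affinePoint x) then m ⟨q, h⟩ a b else 0
    have hf' : ∀ q : dualLine (affinePoint x), f' q = m q a b := fun q => dif_pos q.2
    obtain ⟨z, hz⟩ := isRegular_dualLine_const (x := x) (f := f') (by
      simp only [hf']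
      exact hreg a b)
    exact ⟨z, fun q => by rw [← hf', hz q q.2]⟩
  choose z hz using hconst
  refine ⟨Module.finrank ℂ (LinearMap.range (Matrix.toLin' (Matrix.of z))), fun q hq => ?_⟩
  have h1 : m ⟨q, hq⟩ = Matrix.of z := by
    ext a b
    exact hz a b ⟨q, hq⟩
  have h2 : f q = (e' ⟨q, hq⟩).toLinearMap ∘ₗ Matrix.toLin' (Matrix.of z) ∘ₗ
      (e ⟨q, hq⟩).symm.toLinearMap := by
    rw [← h1, Matrix.toLin'_toMatrix']
    ext v
    simp
  rw [h2, LinearMap.range_comp, LinearMap.range_comp_of_range_eq_top _ (LinearEquiv.range _)]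
  exact LinearEquiv.finrank_map_eq (e' ⟨q, hq⟩) _

/-! ### Incidence of the lines $\lambda_x$ and comparison of the two categories -/

theorem exists_mem_dualLine {q : DualPlane} (hq : q ≠ basePoint) :
    ∃ x, q ∈ dualLine (affinePoint x) := by
  by_cases h1 : q.rep 1 = 0
  · by_cases h2 : q.rep 2 = 0
    · refine absurd ?_ hq
      rw [← q.mk_rep]
      refine (Projectivization.mk_eq_mk_iff' _ _ _ _ _).2 ⟨q.rep 0, ?_⟩
      ext i
      fin_cases i <;> simp [h1, h2]
    · refine ⟨![0, -q.rep 0 / q.rep 2], mem_dualLine_iff.2 ?_⟩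
      simp
      field_simp
      ring
  · refine ⟨![-q.rep 0 / q.rep 1, 0], mem_dualLine_iff.2 ?_⟩
    simp
    field_simp
    ring

/-- The equations of $\lambda_x$ and $\lambda_y$ agree where $(x-y)\cdot(v_1,v_2)=0$, which is the
direction of a base point of the pencil for $x-y$. -/
theorem exists_mem_dualLine_inter (x y : Fin 2 → ℂ) :
    ∃ q, q ∈ dualLine (affinePoint x) ∧ q ∈ dualLine (affinePoint y) := by
  obtain ⟨p, hp⟩ := exists_pencilPt_eq (x - y)
  have h := pencilPt_mem_lineW (x - y) p 0
  rw [← hp 1, pencilPt, mk_mem_lineW_iff] at h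
  refine ⟨_, pencilPt_mem_dualLine x p 0, ?_⟩
  rw [pencilPt, mk_mem_dualLine_iff]
  simp [pencilVec] at h ⊢
  linear_combination h

/-- The rank on each $\lambda_x$ is compared with the rank on $\lambda_0$ at a common point. -/
theorem isMorP_of_trivialOn {X Y : IsObjP.FullSubcategory} (hX : IsObjQ X.obj) (hY : IsObjQ Y.obj)
    (f : X ⟶ Y) : IsMorP f := by
  choose r hr using fun x => exists_finrank_range_eq_on_dualLine f.hom.regular (hX x) (hY x)
  refine ⟨r 0, fun p hp => ?_⟩
  obtain ⟨x, hx⟩ := exists_mem_dualLine hp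
  obtain ⟨q, hq, hq'⟩ := exists_mem_dualLine_inter x 0
  rw [hr x p hx, ← hr x q hq, hr 0 q hq']

theorem isObjP_of_isObjQ {E : EquivBundle} (h : IsObjQ E) : IsObjP E := by
  have := h 0
  rwa [dualLine_affinePoint_zero] at this

/-- Under `h` the condition on morphisms is vacuous, so the inclusion of `CatP`, with codomain
restricted to `CatQ`, is fully faithful and hits every object. -/
theorem exists_equivalence_of_isObjQ (h : ∀ E, IsObjP E → IsObjQ E) :
    ∃ _ : IsMorP.IsMultiplicative, ∃ e : CatP ≌ CatQ, Nonempty (e.functor ⋙ inclQ ≅ inclP) := by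
  have hall : ∀ {X Y : IsObjP.FullSubcategory} (f : X ⟶ Y), IsMorP f := fun {X Y} f =>
    isMorP_of_trivialOn (h _ X.property) (h _ Y.property) f
  have hmul : IsMorP.IsMultiplicative :=
    { id_mem := fun _ => hall _
      comp_mem := fun _ _ _ _ => hall _ }
  refine ⟨hmul, ?_⟩
  let F : CatP ⥤ CatQ := IsObjQ.lift inclP fun X => h _ X.obj.property
  have : F.Faithful := ⟨fun {X Y f g} hfg =>
    WideSubcategory.hom_ext _ (ObjectProperty.hom_ext _ (congrArg (·.hom) hfg))⟩
  have : F.Full := ⟨fun {X Y} f => ⟨⟨ObjectProperty.homMk f.hom, hall _⟩, rfl⟩⟩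
  have : F.EssSurj := ⟨fun Y => ⟨⟨⟨Y.obj, isObjP_of_isObjQ Y.property⟩⟩, ⟨Iso.refl _⟩⟩⟩
  have : F.IsEquivalence := {}
  exact ⟨F.asEquivalence, ⟨IsObjQ.liftCompιIso _ _⟩⟩

/-! ### Laurent series of functions on `𝔾_m × ℙ²` -/

/-- The functions on the plane that become polynomial after multiplication by a power of the first
coordinate. -/
def laurentFunctions : Subalgebra ℂ ((Fin 2 → ℂ) → ℂ) where
  carrier := {g | ∃ (n : ℕ) (N : MvPolynomial (Fin 2) ℂ), ∀ w, w 0 ≠ 0 →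
    g w * w 0 ^ n = eval w N}
  mul_mem' := by
    rintro g g' ⟨n, N, h⟩ ⟨n', N', h'⟩
    refine ⟨n + n', N * N', fun w hw => ?_⟩
    rw [map_mul, ← h w hw, ← h' w hw, Pi.mul_apply]
    ring
  add_mem' := by
    rintro g g' ⟨n, N, h⟩ ⟨n', N', h'⟩
    refine ⟨n + n', N * X 0 ^ n' + N' * X 0 ^ n, fun w hw => ?_⟩
    simp only [map_add, map_mul, map_pow, eval_X, ← h w hw, ← h' w hw, Pi.add_apply]
    ring
  algebraMap_mem' a := ⟨0, C a, fun w _ => by simp⟩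

theorem eval_mem_laurentFunctions (N : MvPolynomial (Fin 2) ℂ) :
    (fun w => eval w N) ∈ laurentFunctions := ⟨0, N, fun w _ => by simp⟩

theorem eval_map_mem_laurentFunctions {T : (Fin 2 → ℂ) → Fin 2 → ℂ} {V : (Fin 2 → ℂ) → Fin 3 → ℂ}
    (hT : ∀ k, (fun w => T w k) ∈ laurentFunctions)
    (hV : ∀ k, (fun w => V w k) ∈ laurentFunctions)
    (F : MvPolynomial (Fin 3) (MvPolynomial (Fin 2) ℂ)) :
    (fun w => eval (V w) (map (eval (T w)) F)) ∈ laurentFunctions := by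
  induction F using MvPolynomial.induction_on with
  | C a =>
    simp only [map_C, eval_C]
    induction a using MvPolynomial.induction_on with
    | C a =>
      simp only [eval_C]
      exact algebraMap_mem laurentFunctions a
    | add a a' h h' =>
      simp only [map_add]
      exact add_mem h h'
    | mul_X a k h =>
      simp only [map_mul, eval_X]
      exact mul_mem h (hT k)
  | add F F' h h' =>
    simp only [map_add]
    exact add_mem h h'
  | mul_X F k h =>
    simp only [map_mul, map_X, eval_X]
    exact mul_mem h (hV k)

theorem pencilVec_mem_laurentFunctions (x : Fin 2 → ℂ) (p : Option ℂ) {γ : ℂ → ℂ}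
    (hγ : (fun w : Fin 2 → ℂ => γ (w 0)) ∈ laurentFunctions) (k : Fin 3) :
    (fun w : Fin 2 → ℂ => pencilVec x (γ (w 0)) p (w 1) k) ∈ laurentFunctions := by
  have h1 : ∀ k, (fun w : Fin 2 → ℂ => pencilVec x 1 p (w 1) k) ∈ laurentFunctions := by
    intro k
    have := eval_mem_laurentFunctions (bind₁ ![1, X 1] (pencilPoly x p k))
    convert this using 2 with w
    rw [eval_bind, ← eval_pencilPoly]
    congr 2
    ext i
    fin_cases i <;> simp
  fin_cases k
  · have := mul_mem hγ (h1 0)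
    convert this using 2 with w
    simp [pencilVec]
    ring
  · exact h1 1
  · exact h1 2

/-- Regularity over $\mathbb G_m$ gives local quotients without any control as $t\to0$. On the
principal open set where `X 0 * H` is nonzero they glue to one quotient by a power of `X 0 * H`
(`exists_global_quotient`). This has a pole of finite order at $t=0$ and coefficients regular at
`p`. -/
theorem exists_rep_of_isRegularPair {Z : Set (Torus × DualPlane)} {f : Torus × DualPlane → ℂ}
    (hf : IsRegularPair (fun z : Z => f z)) (x : Fin 2 → ℂ) (p : Option ℂ)
    {t : ℂ → Torus} (ht : ∀ k, (fun w : Fin 2 → ℂ => (t (w 0) k : ℂ)) ∈ laurentFunctions)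
    {γ : ℂ → ℂ} (hγ : (fun w : Fin 2 → ℂ => γ (w 0)) ∈ laurentFunctions)
    {H : MvPolynomial (Fin 2) ℂ} (hH : eval ![0, 0] H ≠ 0)
    (hZ : ∀ w : Fin 2 → ℂ, w 0 ≠ 0 → eval w H ≠ 0 → (t (w 0), pencilPt x (γ (w 0)) p (w 1)) ∈ Z) :
    ∃ φ ∈ laurentSubring (localRing p).toSubring,
      Rep φ (fun y => f (t y.1, linePt x (γ y.1) y.2)) := by
  have hV := pencilVec_mem_laurentFunctions x p hγ
  obtain ⟨n, N, hN⟩ := exists_global_quotient (X 0 * H)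
    (fun w => f (t (w 0), pencilPt x (γ (w 0)) p (w 1))) (by
    intro w hw
    rw [map_mul, eval_X] at hw
    obtain ⟨d, F, G, hF, hG, hG0, hFG⟩ := hf ⟨_, hZ w (left_ne_zero_of_mul hw)
      (right_ne_zero_of_mul hw)⟩
    have hscale : ∀ w : Fin 2 → ℂ, ∃ l : ℂ, l ≠ 0 ∧
        ∀ F : MvPolynomial (Fin 3) (MvPolynomial (Fin 2) ℂ), F.IsHomogeneous d →
        evalPair (t (w 0), pencilPt x (γ (w 0)) p (w 1)) F
          = l ^ d * eval (pencilVec x (γ (w 0)) p (w 1))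
              (map (eval fun k => (t (w 0) k : ℂ)) F) := by
      intro w
      obtain ⟨l, hl, hrep⟩ := exists_rep_eq_smul _ (pencilVec_ne_zero x (γ (w 0)) p (w 1))
      refine ⟨l, hl, fun F hF => ?_⟩
      rw [evalPair, pencilPt, hrep, eval_smul_of_isHomogeneous (hF.map _)]
    obtain ⟨m, A, hA⟩ := eval_map_mem_laurentFunctions ht hV F
    obtain ⟨m', B, hB⟩ := eval_map_mem_laurentFunctions ht hV G
    -- The powers of $t$ needed to make numerator and denominator polynomial are cleared crosswise.
    refine ⟨X 0 ^ m' * A, X 0 ^ m * B, ?_, fun y hy hy' => ?_⟩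
    · have hw0 := left_ne_zero_of_mul hw
      obtain ⟨l, hl, hl'⟩ := hscale w
      rw [map_mul, map_pow, eval_X, ← hB w hw0]
      rw [hl' G hG] at hG0
      exact mul_ne_zero (pow_ne_zero _ hw0) (mul_ne_zero (right_ne_zero_of_mul hG0)
        (pow_ne_zero _ hw0))
    · rw [map_mul, eval_X] at hy
      have hy0 := left_ne_zero_of_mul hy
      have hyZ := hZ y hy0 (right_ne_zero_of_mul hy)
      obtain ⟨l, hl, hl'⟩ := hscale y
      rw [map_mul, map_pow, eval_X, ← hB y hy0] at hy'
      have hG1 := left_ne_zero_of_mul (right_ne_zero_of_mul hy')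
      have h1 := hFG ⟨_, hyZ⟩
      simp only [hl' F hF, hl' G hG] at h1
      have h2 := h1 (mul_ne_zero (pow_ne_zero _ hl) hG1)
      rw [mul_div_mul_left _ _ (pow_ne_zero _ hl), eq_div_iff hG1] at h2
      simp only [map_mul, map_pow, eval_X, ← hB y hy0, ← hA y hy0, ← h2]
      ring)
  refine exists_rep_laurent (N := N) (n := n) hH ?_
  filter_upwards [eventually_eval_coordVal_ne_zero (p := p) hH, eventually_snd_ne_zero,
    eventually_fst_ne_zero] with y hy hy2 hy1
  have := hN ![y.1, coordVal p y.2] (by simpa using ⟨hy1, hy⟩)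
  simpa [pencilPt_coordVal x _ p hy2] using this

/-! ### Matrices of maps in local trivializations -/

open Classical in
/-- The matrix of a map between two fibres in given charts. -/
def VBundle.mapMatrix (E : VBundle) (i j : E.chart) {q q' : DualPlane}
    (f : E.fiber q →ₗ[ℂ] E.fiber q') : Matrix (Fin E.rank) (Fin E.rank) ℂ :=
  if h : q ∈ E.dom i ∧ q' ∈ E.dom j then
    LinearMap.toMatrix' ((E.triv j ⟨q', h.2⟩).toLinearMap ∘ₗ f ∘ₗ
      (E.triv i ⟨q, h.1⟩).symm.toLinearMap)
  else 0

theorem VBundle.mapMatrix_of_mem (E : VBundle) {i j : E.chart} {q q' : DualPlane}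
    (f : E.fiber q →ₗ[ℂ] E.fiber q') (hi : q ∈ E.dom i) (hj : q' ∈ E.dom j) :
    E.mapMatrix i j f = LinearMap.toMatrix' ((E.triv j ⟨q', hj⟩).toLinearMap ∘ₗ f ∘ₗ
      (E.triv i ⟨q, hi⟩).symm.toLinearMap) :=
  dif_pos ⟨hi, hj⟩

theorem VBundle.mapMatrix_mul (E : VBundle) {i j k : E.chart} {q q' q'' : DualPlane}
    (g : E.fiber q' →ₗ[ℂ] E.fiber q'') (f : E.fiber q →ₗ[ℂ] E.fiber q')
    (hi : q ∈ E.dom i) (hj : q' ∈ E.dom j) (hk : q'' ∈ E.dom k) :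
    E.mapMatrix j k g * E.mapMatrix i j f = E.mapMatrix i k (g ∘ₗ f) := by
  rw [E.mapMatrix_of_mem g hj hk, E.mapMatrix_of_mem f hi hj, E.mapMatrix_of_mem _ hi hk,
    ← LinearMap.toMatrix'_comp]
  congr 1
  refine LinearMap.ext fun v => ?_
  simp

/-- The transition matrix from the chart `i` to the chart `j`. -/
def VBundle.transMatrix (E : VBundle) (i j : E.chart) (q : DualPlane) :
    Matrix (Fin E.rank) (Fin E.rank) ℂ :=
  E.mapMatrix i j (LinearMap.id : E.fiber q →ₗ[ℂ] E.fiber q)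

theorem VBundle.transMatrix_self (E : VBundle) {i : E.chart} {q : DualPlane} (hi : q ∈ E.dom i) :
    E.transMatrix i i q = 1 := by
  rw [VBundle.transMatrix, E.mapMatrix_of_mem _ hi hi, LinearMap.id_comp,
    LinearEquiv.comp_symm, LinearMap.toMatrix'_id]

theorem VBundle.transMatrix_mul (E : VBundle) {i j k : E.chart} {q : DualPlane}
    (hi : q ∈ E.dom i) (hj : q ∈ E.dom j) (hk : q ∈ E.dom k) :
    E.transMatrix j k q * E.transMatrix i j q = E.transMatrix i k q :=
  E.mapMatrix_mul _ _ hi hj hk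

theorem VBundle.isRegular_transMatrix (E : VBundle) (i j : E.chart) (a b : Fin E.rank) :
    IsRegular (fun q : (E.dom i ∩ E.dom j : Set DualPlane) => E.transMatrix i j q a b) := by
  have h := E.transition i j b a
  have h2 : (fun q : (E.dom i ∩ E.dom j : Set DualPlane) => E.transMatrix i j q a b)
      = fun q : (E.dom i ∩ E.dom j : Set DualPlane) =>
        E.triv j ⟨q, q.2.2⟩ ((E.triv i ⟨q, q.2.1⟩).symm (Pi.single b 1)) a := by
    ext q
    rw [VBundle.transMatrix, E.mapMatrix_of_mem _ q.2.1 q.2.2, LinearMap.toMatrix'_apply]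
    simp
  rw [h2]
  exact h

/-- The matrix of the action of `t` on the fibre at `q`. -/
def EquivBundle.actMatrix (E : EquivBundle) (i j : E.chart) (z : Torus × DualPlane) :
    Matrix (Fin E.rank) (Fin E.rank) ℂ :=
  E.mapMatrix i j (E.act z.1 (rfl : z.1 • z.2 = z.1 • z.2))

theorem EquivBundle.actMatrix_eq (E : EquivBundle) (i j : E.chart) {t : Torus} {q q' : DualPlane}
    (h : t • q = q') : E.actMatrix i j (t, q) = E.mapMatrix i j (E.act t h) := by
  subst h
  rfl

theorem EquivBundle.isRegularPair_actMatrix (E : EquivBundle) (i j : E.chart) (a b : Fin E.rank) :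
    IsRegularPair (fun z : {z : Torus × DualPlane | z.2 ∈ E.dom i ∧ z.1 • z.2 ∈ E.dom j} =>
      E.actMatrix i j z a b) := by
  have h := E.act_regular i j b a
  have h2 : (fun z : {z : Torus × DualPlane | z.2 ∈ E.dom i ∧ z.1 • z.2 ∈ E.dom j} =>
      E.actMatrix i j z a b)
      = fun z => E.triv j ⟨z.1.1 • z.1.2, z.2.2⟩
        (E.act z.1.1 rfl ((E.triv i ⟨z.1.2, z.2.1⟩).symm (Pi.single b 1))) a := by
    ext z
    rw [EquivBundle.actMatrix, E.mapMatrix_of_mem _ z.2.1 z.2.2, LinearMap.toMatrix'_apply]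
    simp
  rw [h2]
  exact h

theorem torusPt_inv_smul (x : Fin 2 → ℂ) {c : ℂ} (hc : c ≠ 0) (p : Option ℂ) (u : ℂ) :
    (torusPt c)⁻¹ • pencilPt x c p u = pencilPt x 1 p u := by
  rw [← torusPt_smul x hc, inv_smul_smul]

/-- Both sides are the matrix of one map of fibres, from $L_1$ in the chart `i₀` to $L_c$ in the
chart `j`: the action is an isomorphism of cocycles. -/
theorem EquivBundle.actMatrix_mul_transMatrix (E : EquivBundle) {i₀ i j : E.chart}
    {x : Fin 2 → ℂ} {c z : ℂ} (hc : c ≠ 0) (h0 : linePt x 1 z ∈ E.dom i₀)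
    (h0' : linePt x c z ∈ E.dom i₀) (hi : linePt x 1 z ∈ E.dom i) (hj : linePt x c z ∈ E.dom j) :
    E.actMatrix i j (torusPt c, linePt x 1 z) * E.transMatrix i₀ i (linePt x 1 z)
      = E.transMatrix i₀ j (linePt x c z) * E.actMatrix i₀ i₀ (torusPt c, linePt x 1 z) := by
  have h : torusPt c • linePt x 1 z = linePt x c z := torusPt_smul x hc (some 0) z
  rw [E.actMatrix_eq i j h, E.actMatrix_eq i₀ i₀ h, VBundle.transMatrix, VBundle.transMatrix]
  erw [E.mapMatrix_mul _ _ h0 hi hj, E.mapMatrix_mul _ _ h0 h0' hj]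
  rfl

theorem EquivBundle.actMatrix_mul_inv (E : EquivBundle) {i j : E.chart}
    {x : Fin 2 → ℂ} {c z : ℂ} (hc : c ≠ 0)
    (hi : linePt x 1 z ∈ E.dom i) (hj : linePt x c z ∈ E.dom j) :
    E.actMatrix i j (torusPt c, linePt x 1 z) * E.actMatrix j i ((torusPt c)⁻¹, linePt x c z)
      = 1 := by
  have h : torusPt c • linePt x 1 z = linePt x c z := torusPt_smul x hc (some 0) z
  have h' : (torusPt c)⁻¹ • linePt x c z = linePt x 1 z := torusPt_inv_smul x hc (some 0) z
  rw [E.actMatrix_eq i j h, E.actMatrix_eq j i h']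
  erw [E.mapMatrix_mul _ _ hj hi hj]
  have : E.act (torusPt c) h ∘ₗ E.act (torusPt c)⁻¹ h' = LinearMap.id := by
    refine LinearMap.ext fun v => ?_
    have h1 := E.act_mul (torusPt c) (torusPt c)⁻¹ h' h (by rw [mul_inv_cancel, one_smul]) v
    rw [LinearMap.comp_apply, ← h1]
    have h2 : ∀ (s : Torus) (hs : s • linePt x c z = linePt x c z),
        s = 1 → E.act s hs v = v := by
      rintro s hs rfl
      exact E.act_one _ hs v
    exact h2 _ _ (mul_inv_cancel _)
  erw [this]
  exact E.transMatrix_self hj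

/-- The Laurent series of the action along the pencil, near the point `p`. -/
theorem EquivBundle.exists_rep_actMatrix (E : EquivBundle) {i j : E.chart} {x : Fin 2 → ℂ}
    {p : Option ℂ} (hi : pencilPt x 1 p 0 ∈ E.dom i) (hj : pencilPt x 0 p 0 ∈ E.dom j) :
    ∃ A A' : Matrix (Fin E.rank) (Fin E.rank) (LaurentSeries (RatFunc ℂ)),
      A ∈ (laurentSubring (localRing p).toSubring).matrix ∧
      A' ∈ (laurentSubring (localRing p).toSubring).matrix ∧ A * A' = 1 ∧
      RepMatrix A (fun y => E.actMatrix i j (torusPt y.1, linePt x 1 y.2)) := by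
  obtain ⟨G, hG, hGi⟩ := exists_eval_ne_zero_of_isZariskiOpen (E.isOpen_dom i) hi
  obtain ⟨G', hG', hGj⟩ := exists_eval_ne_zero_of_isZariskiOpen (E.isOpen_dom j) hj
  -- The first factor, with $c=1$ substituted, keeps the point of $L_1$ in the chart `i` for all
  -- $t$. The second keeps the moving point of $L_t$ in the chart `j`.
  let H : MvPolynomial (Fin 2) ℂ := bind₁ ![1, X 1] G * G'
  have hvec : ∀ w : Fin 2 → ℂ, eval w (bind₁ ![1, X 1] G) = eval ![1, w 1] G := by
    intro w
    rw [eval_bind]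
    congr 2
    ext k
    fin_cases k <;> simp
  have hH : eval ![0, 0] H ≠ 0 := by
    rw [map_mul, hvec]
    exact mul_ne_zero hG hG'
  have hi' : ∀ w : Fin 2 → ℂ, eval w H ≠ 0 → pencilPt x 1 p (w 1) ∈ E.dom i := by
    intro w hw
    rw [map_mul, hvec] at hw
    exact hGi _ _ (left_ne_zero_of_mul hw)
  have hj' : ∀ w : Fin 2 → ℂ, eval w H ≠ 0 → pencilPt x (w 0) p (w 1) ∈ E.dom j := by
    intro w hw
    rw [map_mul] at hw
    refine hGj _ _ ?_
    have hw' : w = ![w 0, w 1] := by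
      ext k
      fin_cases k <;> rfl
    rw [← hw']
    exact right_ne_zero_of_mul hw
  have ht : ∀ k, (fun w : Fin 2 → ℂ => (torusPt (w 0) k : ℂ)) ∈ laurentFunctions := fun k =>
    ⟨0, X 0, fun w hw => by simp [torusPt_apply hw]⟩
  have ht' : ∀ k, (fun w : Fin 2 → ℂ => ((torusPt (w 0))⁻¹ k : ℂ)) ∈ laurentFunctions := fun k =>
    ⟨1, 1, fun w hw => by simp [torusPt_apply hw, hw]⟩
  choose A hA hrep using fun a b => exists_rep_of_isRegularPair
    (f := fun z => E.actMatrix i j z a b) (E.isRegularPair_actMatrix i j a b) x p ht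
    (γ := fun _ => 1) (one_mem laurentFunctions) hH
    (fun w hw hw' => ⟨hi' w hw', by rw [torusPt_smul x hw]; exact hj' w hw'⟩)
  choose A' hA' hrep' using fun a b => exists_rep_of_isRegularPair
    (f := fun z => E.actMatrix j i z a b) (E.isRegularPair_actMatrix j i a b) x p ht'
    (t := fun c => (torusPt c)⁻¹) (γ := fun c => c) ⟨0, X 0, fun w _ => by simp⟩ hH
    (fun w hw hw' => ⟨hj' w hw', by rw [torusPt_inv_smul x hw]; exact hi' w hw'⟩)
  refine ⟨Matrix.of A, Matrix.of A', fun a b => hA a b, fun a b => hA' a b, ?_, fun a b => hrep a b⟩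
  have h1 : RepMatrix (Matrix.of A * Matrix.of A') _ :=
    RepMatrix.mul (F := fun y => E.actMatrix i j (torusPt y.1, linePt x 1 y.2))
      (G := fun y => E.actMatrix j i ((torusPt y.1)⁻¹, linePt x y.1 y.2))
      (fun a b => hrep a b) (fun a b => hrep' a b)
  refine (h1.congr ?_).unique RepMatrix.one
  filter_upwards [eventually_fst_ne_zero, eventually_linePt_mem_slice (E.isOpen_dom i) hi,
    eventually_linePt_mem (E.isOpen_dom j) hj] with y hy hi hj
  exact E.actMatrix_mul_inv hy hi hj

/-! ### Bundles that are trivial on the line `W` -/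

theorem HasVal.sum {p : Option ℂ} {ι : Type*} (s : Finset ι) {f : ι → RatFunc ℂ} {a : ι → ℂ}
    (h : ∀ i, HasVal p (f i) (a i)) : HasVal p (∑ i ∈ s, f i) (∑ i ∈ s, a i) := by
  classical
  induction s using Finset.induction_on with
  | empty => simpa using HasVal.const p 0
  | insert i s hi ih =>
    simp only [Finset.sum_insert hi]
    exact (h i).add ih

theorem RepMatrix.mul_laurentConst {r : ℕ} {M N : Matrix (Fin r) (Fin r) (RatFunc ℂ)}
    {F G : ℂ × ℂ → Matrix (Fin r) (Fin r) ℂ} (h : RepMatrix (laurentConst M) F)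
    (h' : RepMatrix (laurentConst N) G) :
    RepMatrix (laurentConst (M * N)) (fun x => F x * G x) := by
  rw [map_mul]
  exact h.mul h'

theorem RepMatrix.unique_laurentConst {r : ℕ} {M N : Matrix (Fin r) (Fin r) (RatFunc ℂ)}
    {F : ℂ × ℂ → Matrix (Fin r) (Fin r) ℂ} (h : RepMatrix (laurentConst M) F)
    (h' : RepMatrix (laurentConst N) F) : M = N := by
  ext1 a b
  exact HahnSeries.C_injective ((h a b).unique (h' a b))

theorem RepMatrix.one_laurentConst {r : ℕ} :
    RepMatrix (laurentConst (1 : Matrix (Fin r) (Fin r) (RatFunc ℂ))) (fun _ => 1) := by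
  rw [map_one]
  exact RepMatrix.one

/-- The germ at `p` of a regular matrix function on a line of the pencil. -/
theorem exists_hasVal_matrix {r : ℕ} {Z : Set DualPlane} {F : DualPlane → Matrix (Fin r) (Fin r) ℂ}
    {x : Fin 2 → ℂ} {c : ℂ} {p : Option ℂ}
    (h : ∀ a b, IsRegularAt (fun q : Z => F q a b) (pencilPt x c p 0))
    (hp : pencilPt x c p 0 ∈ Z) (hZ : ∀ᶠ y in generic, linePt x c y.2 ∈ Z) :
    ∃ M : Matrix (Fin r) (Fin r) (RatFunc ℂ),
      (∀ a b, HasVal p (M a b) (F (pencilPt x c p 0) a b)) ∧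
      RepMatrix (laurentConst M) (fun y => F (linePt x c y.2)) := by
  choose M hM hrep using fun a b =>
    exists_hasVal_of_isRegularAt (f := fun q => F q a b) (h a b) hp hZ
  exact ⟨Matrix.of M, fun a b => hM a b, fun a b => hrep a b⟩

theorem VBundle.exists_hasVal_transMatrix (E : VBundle) {i j : E.chart} {x : Fin 2 → ℂ} {c : ℂ}
    {p : Option ℂ} (hi : pencilPt x c p 0 ∈ E.dom i) (hj : pencilPt x c p 0 ∈ E.dom j) :
    ∃ M : Matrix (Fin E.rank) (Fin E.rank) (RatFunc ℂ),
      (∀ a b, HasVal p (M a b) (E.transMatrix i j (pencilPt x c p 0) a b)) ∧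
      RepMatrix (laurentConst M) (fun y => E.transMatrix i j (linePt x c y.2)) :=
  exists_hasVal_matrix (fun a b => E.isRegular_transMatrix i j a b ⟨_, hi, hj⟩) ⟨hi, hj⟩
    ((eventually_linePt_mem_slice (E.isOpen_dom i) hi).and
      (eventually_linePt_mem_slice (E.isOpen_dom j) hj))

/-- Irreducibility of the line: both charts contain its generic point. -/
theorem VBundle.exists_pencilPt_mem (E : VBundle) {i j : E.chart} {x : Fin 2 → ℂ} {c : ℂ}
    {p p' : Option ℂ} (hi : pencilPt x c p 0 ∈ E.dom i) (hj : pencilPt x c p' 0 ∈ E.dom j) :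
    ∃ p'', pencilPt x c p'' 0 ∈ E.dom i ∧ pencilPt x c p'' 0 ∈ E.dom j := by
  obtain ⟨y, hy⟩ := ((eventually_linePt_mem_slice (E.isOpen_dom i) hi).and
    (eventually_linePt_mem_slice (E.isOpen_dom j) hj)).exists
  exact ⟨some y.2, by rwa [pencilPt_some_zero]⟩

theorem VBundle.exists_repMatrix_transMatrix (E : VBundle) {i j : E.chart} {x : Fin 2 → ℂ} {c : ℂ}
    {p p' : Option ℂ} (hi : pencilPt x c p 0 ∈ E.dom i) (hj : pencilPt x c p' 0 ∈ E.dom j) :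
    ∃ M : Matrix (Fin E.rank) (Fin E.rank) (RatFunc ℂ),
      RepMatrix (laurentConst M) (fun y => E.transMatrix i j (linePt x c y.2)) := by
  obtain ⟨p'', hi', hj'⟩ := E.exists_pencilPt_mem hi hj
  obtain ⟨M, -, hM⟩ := E.exists_hasVal_transMatrix hi' hj'
  exact ⟨M, hM⟩

/-- The power series of a transition matrix along the line `W`. -/
theorem VBundle.exists_powerSeries_transMatrix (E : VBundle) {i j : E.chart} {x : Fin 2 → ℂ}
    {p p' : Option ℂ} (hi : pencilPt x 0 p 0 ∈ E.dom i) (hj : pencilPt x 0 p' 0 ∈ E.dom j) :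
    ∃ Q : Matrix (Fin E.rank) (Fin E.rank) (PowerSeries (RatFunc ℂ)),
      RepMatrix ((HahnSeries.ofPowerSeries ℤ (RatFunc ℂ)).mapMatrix Q)
        (fun y => E.transMatrix i j (linePt x y.1 y.2)) ∧
      RepMatrix (laurentConst (Q.map PowerSeries.constantCoeff))
        (fun y => E.transMatrix i j (linePt x 0 y.2)) := by
  obtain ⟨p'', hi', hj'⟩ := E.exists_pencilPt_mem hi hj
  choose Q hQ hQ0 using fun a b => exists_powerSeries_of_isRegularAt
    (f := fun q => E.transMatrix i j q a b) (E.isRegular_transMatrix i j a b ⟨_, hi', hj'⟩)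
    ((eventually_linePt_mem (E.isOpen_dom i) hi).and (eventually_linePt_mem (E.isOpen_dom j) hj))
    ((eventually_linePt_mem_slice (E.isOpen_dom i) hi).and
      (eventually_linePt_mem_slice (E.isOpen_dom j) hj))
  exact ⟨Matrix.of Q, fun a b => hQ a b, fun a b => hQ0 a b⟩

open Classical in
/-- The matrix of a frame in a chart. -/
def VBundle.frameMatrix (E : VBundle) {Z : Set DualPlane}
    (e : ∀ q : Z, (Fin E.rank → ℂ) ≃ₗ[ℂ] E.fiber q) (j : E.chart) (q : DualPlane) :
    Matrix (Fin E.rank) (Fin E.rank) ℂ :=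
  if h : q ∈ Z ∧ q ∈ E.dom j then
    LinearMap.toMatrix' ((e ⟨q, h.1⟩).trans (E.triv j ⟨q, h.2⟩)).toLinearMap
  else 0

theorem VBundle.frameMatrix_of_mem (E : VBundle) {Z : Set DualPlane}
    (e : ∀ q : Z, (Fin E.rank → ℂ) ≃ₗ[ℂ] E.fiber q) {j : E.chart} {q : DualPlane}
    (h : q ∈ Z) (hj : q ∈ E.dom j) : E.frameMatrix e j q =
      LinearMap.toMatrix' ((e ⟨q, h⟩).trans (E.triv j ⟨q, hj⟩)).toLinearMap :=
  dif_pos ⟨h, hj⟩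

theorem VBundle.transMatrix_mul_frameMatrix (E : VBundle) {Z : Set DualPlane}
    (e : ∀ q : Z, (Fin E.rank → ℂ) ≃ₗ[ℂ] E.fiber q) {i j : E.chart} {q : DualPlane}
    (h : q ∈ Z) (hi : q ∈ E.dom i) (hj : q ∈ E.dom j) :
    E.transMatrix i j q * E.frameMatrix e i q = E.frameMatrix e j q := by
  rw [E.frameMatrix_of_mem e h hi, E.frameMatrix_of_mem e h hj, VBundle.transMatrix,
    E.mapMatrix_of_mem _ hi hj, ← LinearMap.toMatrix'_comp]
  congr 1
  refine LinearMap.ext fun v => ?_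
  simp

/-- The inverse of the frame matrix must be regular at `p` too, since the deformation argument
changes frames in both directions. -/
theorem VBundle.exists_frame_germ (E : VBundle)
    {e : ∀ q : lineW, (Fin E.rank → ℂ) ≃ₗ[ℂ] E.fiber q}
    (he : ∀ i a b, IsRegular (Z := lineW ∩ E.dom i)
      (fun p => E.triv i ⟨p, p.2.2⟩ (e ⟨p, p.2.1⟩ (Pi.single a 1)) b))
    {j : E.chart} {x : Fin 2 → ℂ} {p : Option ℂ} (hj : pencilPt x 0 p 0 ∈ E.dom j) :
    ∃ M M' : Matrix (Fin E.rank) (Fin E.rank) (RatFunc ℂ),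
      M ∈ (localRing p).toSubring.matrix ∧ M' ∈ (localRing p).toSubring.matrix ∧ M * M' = 1 ∧
      RepMatrix (laurentConst M) (fun y => E.frameMatrix e j (linePt x 0 y.2)) := by
  have hmem : pencilPt x 0 p 0 ∈ lineW ∩ E.dom j := ⟨pencilPt_mem_lineW x p 0, hj⟩
  have hZ : ∀ᶠ y in generic, linePt x 0 y.2 ∈ lineW ∩ E.dom j := by
    filter_upwards [eventually_linePt_mem_slice (E.isOpen_dom j) hj] with y hy
    exact ⟨pencilPt_mem_lineW x _ _, hy⟩
  have hreg : ∀ a b, IsRegularAt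
      (fun q : (lineW ∩ E.dom j : Set DualPlane) => E.frameMatrix e j q a b)
      (pencilPt x 0 p 0) := by
    intro a b
    have h1 : (fun q : (lineW ∩ E.dom j : Set DualPlane) => E.frameMatrix e j q a b)
        = fun q : (lineW ∩ E.dom j : Set DualPlane) =>
          E.triv j ⟨q, q.2.2⟩ (e ⟨q, q.2.1⟩ (Pi.single b 1)) a := by
      ext q
      rw [E.frameMatrix_of_mem e q.2.1 q.2.2, LinearMap.toMatrix'_apply]
      simp
    rw [h1]
    exact he j b a ⟨_, hmem⟩
  have hu : ∀ q ∈ lineW ∩ E.dom j, IsUnit (E.frameMatrix e j q) := by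
    intro q hq
    rw [E.frameMatrix_of_mem e hq.1 hq.2]
    exact isUnit_toMatrix_of_linearEquiv _
  obtain ⟨M, hM, hrep⟩ := exists_hasVal_matrix hreg hmem hZ
  obtain ⟨M', hM', hrep'⟩ := exists_hasVal_matrix (F := fun q => (E.frameMatrix e j q)⁻¹)
    (IsRegularAt.matrix_inv hmem hreg (hu _ hmem)) hmem hZ
  refine ⟨M, M', fun a b => (hM a b).mem, fun a b => (hM' a b).mem, ?_, hrep⟩
  refine ((hrep.mul_laurentConst hrep').congr ?_).unique_laurentConst RepMatrix.one_laurentConst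
  filter_upwards [hZ] with y hy
  exact Matrix.mul_nonsing_inv _ ((Matrix.isUnit_iff_isUnit_det _).1 (hu _ hy))

/-- A frame on a line `λ_x`, given by a matrix of rational functions. -/
theorem VBundle.trivialOn_dualLine (E : VBundle) {x : Fin 2 → ℂ} {i₀ : E.chart}
    {p₀ : Option ℂ} (hi₀ : pencilPt x 1 p₀ 0 ∈ E.dom i₀) {ic : Option ℂ → E.chart}
    (hic : ∀ p, pencilPt x 1 p 0 ∈ E.dom (ic p))
    {T : Option ℂ → Matrix (Fin E.rank) (Fin E.rank) (RatFunc ℂ)}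
    (hT : ∀ p, RepMatrix (laurentConst (T p)) (fun y => E.transMatrix i₀ (ic p) (linePt x 1 y.2)))
    {S : Matrix (Fin E.rank) (Fin E.rank) (RatFunc ℂ)}
    {v : Option ℂ → Matrix (Fin E.rank) (Fin E.rank) ℂ}
    (hv : ∀ p a b, HasVal p ((T p * S) a b) (v p a b)) (hu : ∀ p, IsUnit (v p)) :
    E.TrivialOn (dualLine (affinePoint x)) := by
  have hdet : ∀ p, IsUnit (v p).det := fun p => (Matrix.isUnit_iff_isUnit_det _).1 (hu p)
  have hq : ∀ q ∈ dualLine (affinePoint x), q ∈ E.dom (ic (paramOf q)) := by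
    intro q hq
    have := hic (paramOf q)
    rwa [pencilPt_paramOf_of_mem_dualLine hq] at this
  -- At `q` the frame is the matrix `v` in the chart assigned to the parameter of `q`. In any chart
  -- `i` that meets the line, its entries are values of the single rational matrix `Ti * S`.
  refine ⟨fun q => (Matrix.toLin'OfInv (Matrix.nonsing_inv_mul _ (hdet (paramOf q)))
    (Matrix.mul_nonsing_inv _ (hdet (paramOf q)))).trans
      (E.triv (ic (paramOf q)) ⟨q, hq q q.2⟩).symm, fun i a b => ?_⟩
  rcases Set.eq_empty_or_nonempty (dualLine (affinePoint x) ∩ E.dom i) with hempty | ⟨q₁, hq₁, hi⟩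
  · rintro ⟨q, h⟩
    rw [hempty] at h
    exact h.elim
  have hi' := hi
  rw [← pencilPt_paramOf_of_mem_dualLine hq₁] at hi'
  obtain ⟨Ti, hTi⟩ := E.exists_repMatrix_transMatrix hi₀ hi'
  refine isRegular_of_hasVal (g := (Ti * S) b a) ?_ ?_
  · rintro ⟨q, hqx, hqi⟩
    have hpt := pencilPt_paramOf_of_mem_dualLine hqx
    obtain ⟨M, hM, hrep⟩ := E.exists_hasVal_transMatrix (c := 1) (x := x) (p := paramOf q)
      (hic _) (hpt.symm ▸ hqi : pencilPt x 1 (paramOf q) 0 ∈ E.dom i)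
    rw [hpt] at hM
    have h1 : Ti = M * T (paramOf q) := by
      refine hTi.unique_laurentConst ((hrep.mul_laurentConst (hT (paramOf q))).congr ?_)
      filter_upwards [eventually_linePt_mem_slice (E.isOpen_dom i₀) hi₀,
        eventually_linePt_mem_slice (E.isOpen_dom _) (hic (paramOf q)),
        eventually_linePt_mem_slice (E.isOpen_dom i) hi'] with y h h' h''
      exact E.transMatrix_mul h h' h''
    have h2 : HasVal (paramOf q) ((M * (T (paramOf q) * S)) b a)
        ((E.transMatrix (ic (paramOf q)) i q * v (paramOf q)) b a) :=
      HasVal.sum Finset.univ fun k => (hM b k).mul (hv _ k a)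
    rw [h1, Matrix.mul_assoc]
    convert h2 using 1
    rw [VBundle.transMatrix, E.mapMatrix_of_mem _ (hq q hqx) hqi,
      ← LinearMap.toMatrix'_toLin' (v (paramOf q)), ← LinearMap.toMatrix'_comp,
      LinearMap.toMatrix'_apply]
    rfl
  · intro q hqx h1 h2
    have h0 := mem_dualLine_iff.1 hqx.1
    rw [h1, h2] at h0
    refine q.rep_nonzero ?_
    ext k
    fin_cases k
    · simpa using h0
    · exact h1
    · exact h2

/-- `T` holds the transition matrices on $\lambda_x$, `f` the frame on $W$, `Q` the transition
matrices of the family near $W$, and `A` the action. The relations between them required by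
`exists_global_frame_of_formal` are checked at generic points. -/
theorem isObjQ_of_isObjP {E : EquivBundle} (hE : IsObjP E) : IsObjQ E := by
  classical
  obtain ⟨e, he⟩ := hE
  intro x
  -- A chart around a base point of the pencil meets every $L_c$, so `i₀` supplies one generic frame
  -- for $W$, for $\lambda_x$ and for the family.
  obtain ⟨p₀, hp₀⟩ := exists_pencilPt_eq x
  obtain ⟨i₀, hi₀⟩ := E.cover (pencilPt x 0 p₀ 0)
  have hi₁ : pencilPt x 1 p₀ 0 ∈ E.dom i₀ := by rwa [hp₀ 1]
  choose ic hic using fun p => E.cover (pencilPt x 1 p 0)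
  -- Preferring `i₀` wherever it is available makes `Q p = 1` for all but finitely many `p`.
  have hjc' : ∀ p, ∃ j, pencilPt x 0 p 0 ∈ E.dom j ∧ (pencilPt x 0 p 0 ∈ E.dom i₀ → j = i₀) := by
    intro p
    by_cases h : pencilPt x 0 p 0 ∈ E.dom i₀
    · exact ⟨i₀, h, fun _ => rfl⟩
    · obtain ⟨j, hj⟩ := E.cover (pencilPt x 0 p 0)
      exact ⟨j, hj, fun h' => absurd h' h⟩
  choose jc hjc hjc0 using hjc'
  choose T hT using fun p => E.exists_repMatrix_transMatrix hi₁ (hic p)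
  choose T' hT' using fun p => E.exists_repMatrix_transMatrix (hic p) hi₁
  choose f f' hfm hfm' hff hf using fun p => E.exists_frame_germ he (hjc p)
  obtain ⟨f0, f0', -, -, hff0, hf0⟩ := E.exists_frame_germ he hi₀
  choose A A' hAm hAm' hAA hA using fun p => E.exists_rep_actMatrix (hic p) (hjc p)
  obtain ⟨A0, A0', -, -, hAA0, hA0⟩ := E.exists_rep_actMatrix hi₁ hi₀
  choose Q hQ hQ0 using fun p => E.exists_powerSeries_transMatrix hi₀ (hjc p)
  have hsl := eventually_linePt_mem_slice (E.isOpen_dom i₀) hi₁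
  have hsl0 := eventually_linePt_mem_slice (E.isOpen_dom i₀) hi₀
  have hgen := eventually_linePt_mem (E.isOpen_dom i₀) hi₀
  obtain ⟨S, v, hv, hu⟩ := exists_global_frame_of_formal (e := f) (e' := f') (T := T) (T' := T')
    (e0 := f0) (e0' := f0') (A := A) (A' := A') (A0 := A0) (A0' := A0') (Q := Q)
    hff hff0
    (by
      intro p
      refine (((hT' p).mul_laurentConst (hT p)).congr ?_).unique_laurentConst
        RepMatrix.one_laurentConst
      filter_upwards [hsl, eventually_linePt_mem_slice (E.isOpen_dom _) (hic p)] with y h h'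
      rw [E.transMatrix_mul h h' h, E.transMatrix_self h])
    hAA hAA0 hfm hfm' hAm hAm'
    (by
      intro p
      refine (((hA p).mul (hT p)).congr ?_).unique ((hQ p).mul hA0)
      filter_upwards [eventually_fst_ne_zero, hsl, hgen,
        eventually_linePt_mem_slice (E.isOpen_dom _) (hic p),
        eventually_linePt_mem (E.isOpen_dom _) (hjc p)] with y hy h1 h2 h3 h4
      exact E.actMatrix_mul_transMatrix hy h1 h2 h3 h4)
    (by
      intro p
      refine (((hQ0 p).mul_laurentConst hf0).congr ?_).unique_laurentConst (hf p)
      filter_upwards [hsl0, eventually_linePt_mem_slice (E.isOpen_dom _) (hjc p)] with y h h'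
      exact E.transMatrix_mul_frameMatrix e (pencilPt_mem_lineW x _ _) h h')
    (finite_pencilPt_notMem (E.isOpen_dom i₀) hi₀).toFinset
    (by
      intro p hp
      have hpi : pencilPt x 0 p 0 ∈ E.dom i₀ := by simpa using hp
      have h1 : (HahnSeries.ofPowerSeries ℤ (RatFunc ℂ)).mapMatrix (Q p) = 1 := by
        refine ((hQ p).congr ?_).unique RepMatrix.one
        filter_upwards [hgen] with y h
        rw [hjc0 p hpi, E.transMatrix_self h]
      rw [← map_one (HahnSeries.ofPowerSeries ℤ (RatFunc ℂ)).mapMatrix] at h1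
      exact Matrix.map_injective HahnSeries.ofPowerSeries_injective h1)
  exact E.trivialOn_dualLine hi₁ hic hT hv hu

end EquivariantPlane

end

theorem mainTheorem11 :
    ∃ _ : EquivariantPlane.IsMorP.IsMultiplicative,
      ∃ e : EquivariantPlane.CatP ≌ EquivariantPlane.CatQ,
        Nonempty (e.functor ⋙ EquivariantPlane.inclQ ≅ EquivariantPlane.inclP) :=
  EquivariantPlane.exists_equivalence_of_isObjQ fun _ => EquivariantPlane.isObjQ_of_isObjP
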